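/- Let $G$ be a locally compact (Hausdorff) group with left Haar measure $\mu$, let $L^1(G)$ be its group algebra, i.e. the complex Banach algebra $L^1(G,\mu)$ with the convolution product $(f*g)(x)=\int_G f(y)g(y^{-1}x)\,d\mu(y)$, and let $\phi$ be a character of $L^1(G)$, i.e. a non-zero (continuous) multiplicative linear functional on $L^1(G)$. Then the following statements are equivalent: (i) the second dual $L^1(G)^{**}$, a Banach algebra with the first Arens product, is left $\tilde\phi$-biflat, where $\tilde\phi$ is the character of $L^1(G)^{**}$ given by $\tilde\phi(F)=F(\phi)$; (ii) $L^1(G)$ is left $\phi$-biflat; (iii) $G$ is amenable, i.e. there is a linear functional $M$ on $L^\infty(G)$ with $\|M\|=M(1)=1$ and $M(L_yf)=M(f)$ for all $y\in G$ and $f\in L^\infty(G)$, where $(L_yf)(x)=f(y^{-1}x)$. Here a Banach algebra $A$ with a character $\phi$ is called left $\phi$-biflat if there is a bounded linear map $\rho:A\to(A\otimes_pA)^{**}$ such that $$\rho(ab)=\phi(b)\rho(a)=a\cdot\rho(b),\qquad \tilde\phi\circ\pi_A^{**}\circ\rho(a)=\phi(a)\qquad(a,b\in A),$$ where $A\otimes_pA$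 is the (completed) projective tensor product, $\pi_A:A\otimes_pA\to A$ is the bounded linear map with $\pi_A(a\otimes b)=ab$, $\tilde\phi(F)=F(\phi)$ for $F\in A^{**}$, and $a\cdot{}$ is the second adjoint of the bounded operator on $A\otimes_pA$ with $b\otimes c\mapsto ab\otimes c$. -/

import Mathlib

open MeasureTheory WeakDual
open scoped ENNReal TensorProduct

set_option maxSynthPendingDepth 3
set_option linter.unusedSectionVars false

noncomputable section

namespace LeftBiflat

section Bidual

/-- The second dual `X**` of a normed space. -/
abbrev Bidual (X : Type*) [NormedAddCommGroup X] [NormedSpace ℂ X] : Type _ :=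
  StrongDual ℂ (StrongDual ℂ X)

variable {X Y Z : Type*} [NormedAddCommGroup X] [NormedSpace ℂ X]
  [NormedAddCommGroup Y] [NormedSpace ℂ Y] [NormedAddCommGroup Z] [NormedSpace ℂ Z]

/-- The adjoint `T* : Y* → X*`, `T* f = f ∘ T`, of a bounded operator `T : X → Y`. -/
def dualMap (T : X →L[ℂ] Y) : StrongDual ℂ Y →L[ℂ] StrongDual ℂ X :=
  (ContinuousLinearMap.compL ℂ X Y ℂ).flip T

@[simp] theorem dualMap_apply (T : X →L[ℂ] Y) (f : StrongDual ℂ Y) (x : X) :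
    dualMap T f x = f (T x) := rfl

/-- The second adjoint `T** : X** → Y**` of a bounded operator `T : X → Y`. -/
def bidualMap (T : X →L[ℂ] Y) : Bidual X →L[ℂ] Bidual Y := dualMap (dualMap T)

@[simp] theorem bidualMap_apply (T : X →L[ℂ] Y) (F : Bidual X) (f : StrongDual ℂ Y) :
    bidualMap T F f = F (dualMap T f) := rfl

/-- The Arens adjoint `m* : Z* × X → Y*`, `m*(f, x)(y) = f (m (x, y))`, of a bounded bilinear
map `m : X × Y → Z`. -/
def arensAdjoint (m : X →L[ℂ] Y →L[ℂ] Z) : StrongDual ℂ Z →L[ℂ] X →L[ℂ] StrongDual ℂ Y :=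
  ((ContinuousLinearMap.compL ℂ Y Z ℂ).flip.comp m).flip

@[simp] theorem arensAdjoint_apply (m : X →L[ℂ] Y →L[ℂ] Z) (f : StrongDual ℂ Z) (x : X) (y : Y) :
    arensAdjoint m f x y = f (m x y) := rfl

theorem norm_arensAdjoint_le (m : X →L[ℂ] Y →L[ℂ] Z) : ‖arensAdjoint m‖ ≤ ‖m‖ := by
  refine ContinuousLinearMap.opNorm_le_bound _ (norm_nonneg _) fun f => ?_
  refine ContinuousLinearMap.opNorm_le_bound _ (by positivity) fun x => ?_
  refine ContinuousLinearMap.opNorm_le_bound _ (by positivity) fun y => ?_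
  rw [arensAdjoint_apply]
  calc ‖f (m x y)‖ ≤ ‖f‖ * ‖m x y‖ := f.le_opNorm _
    _ ≤ ‖f‖ * (‖m‖ * ‖x‖ * ‖y‖) := by gcongr; exact m.le_opNorm₂ x y
    _ = ‖m‖ * ‖f‖ * ‖x‖ * ‖y‖ := by ring

end Bidual

section Banach

variable (A : Type*) [NonUnitalNormedRing A] [NormedSpace ℂ A] [IsScalarTower ℂ A A]
  [SMulCommClass ℂ A A]

/-- The second dual `A**` of a Banach algebra, as a Banach algebra with the first Arens product
`□`: `(F □ G)(f) = F (G · f)`, `(G · f)(a) = G (f · a)`, `(f · a)(b) = f (a b)` for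
`F, G ∈ A**`, `f ∈ A*`, `a, b ∈ A`. -/
def ArensBidual : Type _ := Bidual A

namespace ArensBidual

instance : NormedAddCommGroup (ArensBidual A) := inferInstanceAs (NormedAddCommGroup (Bidual A))
instance : NormedSpace ℂ (ArensBidual A) := inferInstanceAs (NormedSpace ℂ (Bidual A))
instance : CompleteSpace (ArensBidual A) := inferInstanceAs (CompleteSpace (Bidual A))

/-- The first Arens product on `A**`, as a bounded bilinear map. -/
def arensMul : Bidual A →L[ℂ] Bidual A →L[ℂ] Bidual A :=
  arensAdjoint (arensAdjoint (arensAdjoint (ContinuousLinearMap.mul ℂ A)))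

theorem norm_arensMul_le : ‖arensMul A‖ ≤ 1 :=
  (norm_arensAdjoint_le _).trans <| (norm_arensAdjoint_le _).trans <|
    (norm_arensAdjoint_le _).trans (ContinuousLinearMap.opNorm_mul_le ℂ A)

variable {A}

/-- `f · a ∈ A*`, `(f · a)(b) = f (a b)`. -/
def dualMulRight (f : StrongDual ℂ A) (a : A) : StrongDual ℂ A :=
  arensAdjoint (ContinuousLinearMap.mul ℂ A) f a

/-- `G · f ∈ A*`, `(G · f)(a) = G (f · a)`. -/
def dualMulLeft (G : Bidual A) (f : StrongDual ℂ A) : StrongDual ℂ A :=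
  arensAdjoint (arensAdjoint (ContinuousLinearMap.mul ℂ A)) G f

theorem dualMulRight_apply (f : StrongDual ℂ A) (a b : A) : dualMulRight f a b = f (a * b) := rfl

theorem dualMulLeft_apply (G : Bidual A) (f : StrongDual ℂ A) (a : A) :
    dualMulLeft G f a = G (dualMulRight f a) := rfl

theorem arensMul_apply (F G : Bidual A) (f : StrongDual ℂ A) :
    arensMul A F G f = F (dualMulLeft G f) := rfl

theorem arensMul_assoc (F G H : Bidual A) :
    arensMul A (arensMul A F G) H = arensMul A F (arensMul A G H) := by
  have h1 (f : StrongDual ℂ A) (a b : A) :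
      dualMulRight f (a * b) = dualMulRight (dualMulRight f a) b :=
    ContinuousLinearMap.ext fun c => congrArg f (mul_assoc a b c)
  have h2 (f : StrongDual ℂ A) (a : A) :
      dualMulRight (dualMulLeft H f) a = dualMulLeft H (dualMulRight f a) :=
    ContinuousLinearMap.ext fun b => congrArg H (h1 f a b)
  have h3 (f : StrongDual ℂ A) : dualMulLeft G (dualMulLeft H f) = dualMulLeft (arensMul A G H) f :=
    ContinuousLinearMap.ext fun a => congrArg G (h2 f a)
  exact ContinuousLinearMap.ext fun f => congrArg F (h3 f)

variable (A)

instance : NonUnitalNormedRing (ArensBidual A) :=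
  { (inferInstance : NormedAddCommGroup (ArensBidual A)) with
    mul := fun F G => arensMul A F G
    left_distrib := fun F G H => map_add (arensMul A F) G H
    right_distrib := fun F G H => congrArg (fun T => T H) (map_add (arensMul A) F G)
    zero_mul := fun F => congrArg (fun T => T F) (map_zero (arensMul A))
    mul_zero := fun F => map_zero (arensMul A F)
    mul_assoc := fun F G H => arensMul_assoc F G H
    norm_mul_le := fun F G => by
      refine ((arensMul A).le_opNorm₂ F G).trans ?_
      have h := norm_arensMul_le A
      have : ‖arensMul A‖ * ‖(F : Bidual A)‖ ≤ 1 * ‖(F : Bidual A)‖ := by gcongr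
      rw [one_mul] at this
      exact mul_le_mul_of_nonneg_right this (norm_nonneg _) }

instance : IsScalarTower ℂ (ArensBidual A) (ArensBidual A) :=
  ⟨fun c F G => congrArg (fun T => T G) (map_smul (arensMul A) c F)⟩

instance : SMulCommClass ℂ (ArensBidual A) (ArensBidual A) :=
  ⟨fun c F G => (map_smul (arensMul A F) c G).symm⟩

variable {A}

theorem mul_def (F G : ArensBidual A) : F * G = arensMul A F G := rfl

end ArensBidual

variable {A}

/-- A character of `A`, as an element of `A*`. -/
def charDual (φ : characterSpace ℂ A) : StrongDual ℂ A := WeakDual.toStrongDual (φ : WeakDual ℂ A)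

/-- The extension `φ̃ ∈ Δ(A**)` of a character `φ ∈ Δ(A)`, given by `φ̃(F) = F(φ)`. -/
def charExtend (φ : characterSpace ℂ A) : characterSpace ℂ (ArensBidual A) :=
  ⟨StrongDual.toWeakDual
      (NormedSpace.inclusionInDoubleDual ℂ (StrongDual ℂ A) (charDual φ) :
        StrongDual ℂ (Bidual A)), by
    have hφ := φ.2
    refine ⟨fun h => hφ.1 ?_, fun (F G : Bidual A) => ?_⟩
    · refine DFunLike.ext _ _ fun a => ?_
      exact DFunLike.congr_fun h (NormedSpace.inclusionInDoubleDual ℂ A a : Bidual A)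
    · change F (ArensBidual.dualMulLeft G (charDual φ)) = F (charDual φ) * G (charDual φ)
      have : ArensBidual.dualMulLeft G (charDual φ) = G (charDual φ) • charDual φ := by
        ext a
        have h2 : ArensBidual.dualMulRight (charDual φ) a = (φ : WeakDual ℂ A) a • charDual φ := by
          ext b
          exact hφ.2 a b
        rw [ArensBidual.dualMulLeft_apply, h2, map_smul]
        exact mul_comm _ _
      rw [this, map_smul, smul_eq_mul, mul_comm]⟩

theorem charExtend_apply (φ : characterSpace ℂ A) (F : ArensBidual A) :
    charExtend φ F = (show Bidual A from F) (charDual φ) := rfl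

variable (A)

/-- The projective tensor product `A ⊗_p A`: the completion of the algebraic tensor product
with respect to the projective norm `‖u‖ = inf ∑ ‖aᵢ‖ ‖bᵢ‖`, the infimum being over all
representations `u = ∑ aᵢ ⊗ bᵢ`. -/
abbrev ProjTensor : Type _ := UniformSpace.Completion (⨂[ℂ] _ : Fin 2, A)

variable {A}

/-- The elementary tensor `a ⊗ b` in `A ⊗_p A`. -/
def ptmul (a b : A) : ProjTensor A := ((⨂ₜ[ℂ] i, (![a, b] : Fin 2 → A) i : ⨂[ℂ] _ : Fin 2, A) :)

/-- The bounded extension to the completion of a bounded operator on the algebraic tensor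
product. -/
def extendCompl {E F : Type*} [SeminormedAddCommGroup E] [NormedSpace ℂ E]
    [NormedAddCommGroup F] [NormedSpace ℂ F] [CompleteSpace F] (T : E →L[ℂ] F) :
    UniformSpace.Completion E →L[ℂ] F :=
  T.extend (UniformSpace.Completion.toComplL : E →L[ℂ] UniformSpace.Completion E)

theorem extendCompl_coe {E F : Type*} [SeminormedAddCommGroup E] [NormedSpace ℂ E]
    [NormedAddCommGroup F] [NormedSpace ℂ F] [CompleteSpace F] (T : E →L[ℂ] F) (x : E) :
    extendCompl T (x : UniformSpace.Completion E) = T x :=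
  ContinuousLinearMap.extend_eq T
    (UniformSpace.Completion.denseRange_coe)
    (UniformSpace.Completion.isUniformInducing_coe E) x

/-- The left action of `a ∈ A` on `A ⊗_p A`: the bounded operator with
`a · (b ⊗ c) = a b ⊗ c`. -/
def leftAct (a : A) : ProjTensor A →L[ℂ] ProjTensor A :=
  extendCompl <| UniformSpace.Completion.toComplL.comp <|
    PiTensorProduct.mapL (𝕜 := ℂ) (E := fun _ : Fin 2 => A) (E' := fun _ : Fin 2 => A)
      ![ContinuousLinearMap.mul ℂ A a, ContinuousLinearMap.id ℂ A]

theorem leftAct_ptmul (a b c : A) : leftAct a (ptmul b c) = ptmul (a * b) c := by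
  rw [leftAct, ptmul, extendCompl_coe]
  simp only [ContinuousLinearMap.comp_apply, PiTensorProduct.mapL_apply, PiTensorProduct.map_tprod]
  rw [ptmul, UniformSpace.Completion.coe_toComplL]
  congr 2
  funext i
  fin_cases i <;> rfl

variable (A)

/-- The product of `A` as a bounded multilinear map of two variables. -/
def mulMulti : ContinuousMultilinearMap ℂ (fun _ : Fin 2 => A) A :=
  ContinuousLinearMap.uncurryLeft (n := 1) (Ei := fun _ => A)
    (((continuousMultilinearCurryFin1 ℂ A A).symm : (A →L[ℂ] A) →L[ℂ] _).comp
      (ContinuousLinearMap.mul ℂ A))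

variable {A} in
theorem mulMulti_apply (v : Fin 2 → A) : mulMulti A v = v 0 * v 1 := rfl

/-- The product morphism `π_A : A ⊗_p A → A`, `π_A (a ⊗ b) = a b`. -/
def prodMor [CompleteSpace A] : ProjTensor A →L[ℂ] A :=
  extendCompl (PiTensorProduct.liftIsometry ℂ (fun _ : Fin 2 => A) A (mulMulti A))

variable {A}

theorem prodMor_ptmul [CompleteSpace A] (a b : A) : prodMor A (ptmul a b) = a * b := by
  rw [prodMor, ptmul, extendCompl_coe, PiTensorProduct.liftIsometry_apply_apply,
    PiTensorProduct.lift.tprod]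
  rfl

/-- `A` is left `φ`-biflat: there is a bounded linear map `ρ : A → (A ⊗_p A)**` with
`ρ(ab) = φ(b) ρ(a) = a · ρ(b)` and `φ̃ (π_A** (ρ(a))) = φ(a)` for all `a, b ∈ A`.
The action of `a` on `(A ⊗_p A)**` is the second dual of its left action on `A ⊗_p A`:
`(a · M)(f) = M(f · a)`, `(f · a)(x) = f(a · x)`. -/
def IsLeftBiflat [CompleteSpace A] (φ : characterSpace ℂ A) : Prop :=
  ∃ ρ : A →L[ℂ] Bidual (ProjTensor A),
    (∀ a b : A, ρ (a * b) = φ b • ρ a) ∧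
    (∀ a b : A, ρ (a * b) = bidualMap (leftAct a) (ρ b)) ∧
    ∀ a : A, charExtend φ (bidualMap (prodMor A) (ρ a) : Bidual A) = φ a

end Banach

section Group

variable {G : Type*} [Group G] [TopologicalSpace G] [IsTopologicalGroup G]
  [MeasurableSpace G] [BorelSpace G]

/-- The Banach space `L¹(G)` with respect to the measure `μ`; the convolution product is
defined below. -/
def L1 {G : Type*} [MeasurableSpace G] (μ : Measure G) : Type _ := Lp ℂ 1 μ

namespace L1

instance {G : Type*} [MeasurableSpace G] (μ : Measure G) : NormedAddCommGroup (L1 μ) :=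
  inferInstanceAs (NormedAddCommGroup (Lp ℂ 1 μ))
instance {G : Type*} [MeasurableSpace G] (μ : Measure G) : NormedSpace ℂ (L1 μ) :=
  inferInstanceAs (NormedSpace ℂ (Lp ℂ 1 μ))
instance {G : Type*} [MeasurableSpace G] (μ : Measure G) : CompleteSpace (L1 μ) :=
  inferInstanceAs (CompleteSpace (Lp ℂ 1 μ))

end L1

/-- The left translate `(L_y f)(x) = f (y⁻¹ x)` of `f ∈ Lᵖ(G)`. -/
def translate {μ : Measure G} [μ.IsHaarMeasure] {p : ℝ≥0∞} (y : G) (f : Lp ℂ p μ) : Lp ℂ p μ :=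
  DomMulAct.mk y⁻¹ • f

theorem translate_ae_eq {μ : Measure G} [μ.IsHaarMeasure] {p : ℝ≥0∞} (y : G) (f : Lp ℂ p μ) :
    translate y f =ᵐ[μ] fun x => f (y⁻¹ * x) :=
  DomMulAct.smul_Lp_ae_eq _ _

variable [LocallyCompactSpace G]

theorem continuous_translate (μ : Measure G) [μ.IsHaarMeasure] [μ.Regular] (g : Lp ℂ 1 μ) :
    Continuous fun y : G => translate y g := by
  have : Fact ((1 : ℝ≥0∞) ≠ ∞) := ⟨ENNReal.one_ne_top⟩
  have h1 : Continuous fun y : G => DomMulAct.mk y⁻¹ :=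
    DomMulAct.continuous_mk.comp continuous_inv
  exact h1.smul continuous_const

theorem aestronglyMeasurable_translate (μ : Measure G) [μ.IsHaarMeasure] [μ.Regular]
    (g : Lp ℂ 1 μ) {s : Set G} (hs : MeasurableSet s) (hμ : μ s ≠ ∞) :
    AEStronglyMeasurable (fun y => translate y g) (μ.restrict s) := by
  have hex : ∀ n : ℕ, ∃ K ⊆ s, IsCompact K ∧ IsClosed K ∧ μ s < μ K + ((n : ℝ≥0∞) + 1)⁻¹ :=
    fun n => hs.exists_isCompact_isClosed_lt_add hμ (by simp)
  choose K hKs hKc hKcl hK using hex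
  have hsub : (⋃ n, K n) ⊆ s := Set.iUnion_subset hKs
  have hle : μ s ≤ μ (⋃ n, K n) := by
    refine ENNReal.le_of_forall_pos_le_add fun ε hε _ => ?_
    obtain ⟨n, hn⟩ := ENNReal.exists_inv_nat_lt (ENNReal.coe_pos.2 hε).ne'
    refine (hK n).le.trans (add_le_add (measure_mono (Set.subset_iUnion K n)) ?_)
    refine le_trans (ENNReal.inv_le_inv.2 ?_) hn.le
    exact le_self_add
  have hae : (⋃ n, K n : Set G) =ᵐ[μ] s :=
    ae_eq_of_subset_of_measure_ge hsub hle
      (MeasurableSet.iUnion fun n => (hKcl n).measurableSet).nullMeasurableSet hμ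
  rw [← Measure.restrict_congr_set hae, aestronglyMeasurable_iUnion_iff]
  exact fun n => (continuous_translate μ g).continuousOn.aestronglyMeasurable_of_isCompact
    (hKc n) (hKcl n).measurableSet

theorem integrable_smul_translate (μ : Measure G) [μ.IsHaarMeasure] [μ.Regular]
    {f : G → ℂ} (hf : Integrable f μ) (g : Lp ℂ 1 μ) :
    Integrable (fun y => f y • translate y g) μ := by
  have hn : ∀ y, ‖translate y g‖ = ‖g‖ := fun y => DomMulAct.norm_smul_Lp _ _
  refine (hf.norm.mul_const ‖g‖).mono' ?_ (.of_forall fun y => by rw [norm_smul, hn])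
  have hfin : AEFinStronglyMeasurable f μ := hf.aefinStronglyMeasurable
  set t := hfin.sigmaFiniteSet
  have ht : MeasurableSet t := hfin.measurableSet
  have hst : SigmaFinite (μ.restrict t) := hfin.sigmaFinite_restrict
  have hT : AEStronglyMeasurable (fun y => translate y g) (μ.restrict t) := by
    rw [← Measure.restrict_univ (μ := μ.restrict t), ← iUnion_spanningSets (μ.restrict t),
      aestronglyMeasurable_iUnion_iff]
    intro n
    have hm := measurableSet_spanningSets (μ.restrict t) n
    rw [Measure.restrict_restrict hm]
    refine aestronglyMeasurable_translate μ g (hm.inter ht) ?_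
    rw [← Measure.restrict_apply hm]
    exact (measure_spanningSets_lt_top (μ.restrict t) n).ne
  suffices h : AEStronglyMeasurable (fun y => f y • translate y g) (μ.restrict (t ∪ tᶜ)) by
    rwa [Set.union_compl_self, Measure.restrict_univ] at h
  rw [aestronglyMeasurable_union_iff]
  refine ⟨hf.1.restrict.smul hT, ?_⟩
  refine (aestronglyMeasurable_const (b := (0 : Lp ℂ 1 μ))).congr ?_
  filter_upwards [hfin.ae_eq_zero_compl] with y hy
  rw [hy, Pi.zero_apply, zero_smul]

/-- Translation as a bounded operator on `L¹(G)`. -/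
def translateL (μ : Measure G) [μ.IsHaarMeasure] (y : G) : Lp ℂ 1 μ →L[ℂ] Lp ℂ 1 μ :=
  LinearMap.mkContinuous
    { toFun := fun g => translate y g
      map_add' := fun g h => smul_add _ g h
      map_smul' := fun c g => smul_comm (DomMulAct.mk y⁻¹) c g } 1
    fun g => by rw [one_mul]; exact (DomMulAct.norm_smul_Lp _ _).le

theorem translateL_apply (μ : Measure G) [μ.IsHaarMeasure] (y : G) (g : Lp ℂ 1 μ) :
    translateL μ y g = translate y g := rfl

theorem translate_translate {μ : Measure G} [μ.IsHaarMeasure] {p : ℝ≥0∞} (y z : G) (g : Lp ℂ p μ) :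
    translate y (translate z g) = translate (y * z) g := by
  simp only [translate, smul_smul, ← DomMulAct.mk_mul, mul_inv_rev]

/-- The convolution `f * g = ∫ f(y) L_y g dy` of `f, g ∈ L¹(G)`, a Bochner integral in `L¹(G)`;
that is, `(f * g)(x) = ∫ f(y) g(y⁻¹ x) dy`. -/
def conv (μ : Measure G) [μ.IsHaarMeasure] (f g : Lp ℂ 1 μ) : Lp ℂ 1 μ :=
  ∫ y, f y • translate y g ∂μ

section conv

variable (μ : Measure G) [μ.IsHaarMeasure] [μ.Regular]

theorem integrable_conv (f g : Lp ℂ 1 μ) : Integrable (fun y => f y • translate y g) μ :=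
  integrable_smul_translate μ (L1.integrable_coeFn f) g

/-- The integrals of `f * g` are those of the pointwise convolution integral. -/
theorem setIntegral_conv (f g : Lp ℂ 1 μ) (s : Set G) :
    ∫ x in s, conv μ f g x ∂μ = ∫ y, f y * ∫ x in s, g (y⁻¹ * x) ∂μ ∂μ := by
  have key : ∀ h : Lp ℂ 1 μ, ∫ x in s, h x ∂μ =
      (L1.integralCLM (E := ℂ) (μ := μ.restrict s)).comp (LpToLpRestrictCLM G ℂ ℝ μ 1 s) h := by
    intro h
    rw [ContinuousLinearMap.comp_apply, ← integral_congr_ae (LpToLpRestrictCLM_coeFn ℝ s h),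
      ← L1.integral_eq_integral, L1.integral_eq]
  rw [key, conv, ← ContinuousLinearMap.integral_comp_comm _ (integrable_conv μ f g)]
  refine integral_congr_ae (.of_forall fun y => ?_)
  simp only
  rw [← key, ← integral_const_mul]
  refine integral_congr_ae (ae_restrict_of_ae ?_)
  filter_upwards [translate_ae_eq y g, Lp.coeFn_smul (f y) (translate y g)] with x h1 h2
  rw [h2, Pi.smul_apply, h1, smul_eq_mul]

theorem conv_add (f g h : Lp ℂ 1 μ) : conv μ f (g + h) = conv μ f g + conv μ f h := by
  rw [conv, conv, conv, ← integral_add (integrable_conv μ f g) (integrable_conv μ f h)]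
  refine integral_congr_ae (.of_forall fun y => ?_)
  simp only [← translateL_apply, map_add, smul_add]

theorem add_conv (f g h : Lp ℂ 1 μ) : conv μ (f + g) h = conv μ f h + conv μ g h := by
  rw [conv, conv, conv, ← integral_add (integrable_conv μ f h) (integrable_conv μ g h)]
  refine integral_congr_ae ?_
  filter_upwards [Lp.coeFn_add f g] with y hy
  rw [hy, Pi.add_apply, add_smul]

theorem conv_smul (c : ℂ) (f g : Lp ℂ 1 μ) : conv μ f (c • g) = c • conv μ f g := by
  rw [conv, conv, ← integral_smul]
  refine integral_congr_ae (.of_forall fun y => ?_)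
  simp only [← translateL_apply, map_smul]
  rw [smul_comm]

theorem smul_conv (c : ℂ) (f g : Lp ℂ 1 μ) : conv μ (c • f) g = c • conv μ f g := by
  rw [conv, conv, ← integral_smul]
  refine integral_congr_ae ?_
  filter_upwards [Lp.coeFn_smul c f] with y hy
  rw [hy, Pi.smul_apply, smul_eq_mul, mul_smul]

theorem norm_conv_le (f g : Lp ℂ 1 μ) : ‖conv μ f g‖ ≤ ‖f‖ * ‖g‖ := by
  refine (norm_integral_le_integral_norm _).trans ?_
  rw [L1.norm_eq_integral_norm, ← integral_mul_const]
  refine (integral_congr_ae (.of_forall fun y => ?_)).le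
  simp only [norm_smul]
  congr 1
  exact DomMulAct.norm_smul_Lp _ _

/-- Convolution as a bounded bilinear map. -/
def convL : Lp ℂ 1 μ →L[ℂ] Lp ℂ 1 μ →L[ℂ] Lp ℂ 1 μ :=
  LinearMap.mkContinuous₂
    (LinearMap.mk₂ ℂ (conv μ) (add_conv μ) (smul_conv μ) (conv_add μ) (conv_smul μ)) 1
    fun f g => by rw [one_mul]; exact norm_conv_le μ f g

theorem convL_apply (f g : Lp ℂ 1 μ) : convL μ f g = conv μ f g := rfl

theorem translate_conv (y : G) (f g : Lp ℂ 1 μ) :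
    translate y (conv μ f g) = conv μ (translate y f) g := by
  rw [← translateL_apply, conv, ← ContinuousLinearMap.integral_comp_comm _ (integrable_conv μ f g)]
  have h : conv μ (translate y f) g = ∫ z, f (y⁻¹ * z) • translate z g ∂μ := by
    refine integral_congr_ae ?_
    filter_upwards [translate_ae_eq y f] with z hz
    rw [hz]
  rw [h, ← integral_mul_left_eq_self (fun z => f (y⁻¹ * z) • translate z g) y]
  refine integral_congr_ae (.of_forall fun z => ?_)
  simp only [map_smul, translateL_apply, translate_translate, inv_mul_cancel_left]

theorem conv_assoc (f g h : Lp ℂ 1 μ) : conv μ (conv μ f g) h = conv μ f (conv μ g h) := by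
  have e : conv μ (conv μ f g) h = (convL μ).flip h (∫ y, f y • translate y g ∂μ) := rfl
  rw [e, ← ContinuousLinearMap.integral_comp_comm _ (integrable_conv μ f g)]
  refine integral_congr_ae (.of_forall fun y => ?_)
  simp only [map_smul, ContinuousLinearMap.flip_apply, convL_apply, translate_conv]

/-- `L¹(G)` is a Banach algebra under convolution. -/
instance : NonUnitalNormedRing (L1 μ) :=
  { (inferInstance : NormedAddCommGroup (L1 μ)) with
    mul := fun f g => conv μ f g
    left_distrib := fun f g h => conv_add μ f g h
    right_distrib := fun f g h => add_conv μ f g h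
    zero_mul := fun f => congrArg (fun T => T f) (map_zero (convL μ))
    mul_zero := fun f => map_zero (convL μ f)
    mul_assoc := fun f g h => conv_assoc μ f g h
    norm_mul_le := fun f g => norm_conv_le μ f g }

instance : IsScalarTower ℂ (L1 μ) (L1 μ) := ⟨fun c f g => smul_conv μ c f g⟩

instance : SMulCommClass ℂ (L1 μ) (L1 μ) := ⟨fun c f g => (conv_smul μ c f g).symm⟩

theorem L1.mul_def (f g : L1 μ) : f * g = conv μ f g := rfl

end conv

/-- `G` is amenable: there is a left invariant mean on `L^∞(G)`, that is, a linear functional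
`M` with `‖M‖ = M(1) = 1` and `M(L_y f) = M(f)` for all `y ∈ G` and `f ∈ L^∞(G)`. Here `μ` is a
left Haar measure of `G`. -/
def IsAmenable (μ : Measure G) [μ.IsHaarMeasure] : Prop :=
  ∃ M : StrongDual ℂ (Lp ℂ ∞ μ),
    ‖M‖ = 1 ∧ M ((memLp_top_const (1 : ℂ)).toLp (fun _ : G => (1 : ℂ))) = 1 ∧
    ∀ (y : G) (f : Lp ℂ ∞ μ), M (translate y f) = M f

end Group

end LeftBiflat

end

open MeasureTheory WeakDual
open scoped ENNReal TensorProduct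

set_option maxSynthPendingDepth 3

noncomputable section

namespace LeftBiflat

/-! ### Left φ-amenability and left φ-biflatness of Banach algebras -/

section Abstract

variable {A : Type*} [NonUnitalNormedRing A] [NormedSpace ℂ A] [IsScalarTower ℂ A A]
  [SMulCommClass ℂ A A]

open ArensBidual (dualMulRight dualMulRight_apply)

/-! Both biflatness conditions and amenability of G are equivalent to left φ-amenability of A =
L¹(G): the existence of m ∈ A** with m(f · a) = φ(a) m(f) and m(φ) = 1. Given m and c with φ(c) = 1,
the map ρ(a) = φ(a) (m ⊗ c) witnesses biflatness of A; moreover m, viewed in A****, is such a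
functional for φ̃ on A**, so A** is biflat too. Conversely, left approximate units force ρ to vanish
on ker φ, hence ρ = φ(·) ρ(c), and π**(ρ(c)) is the required m. Run along the embedding A → A**, the
same argument treats the second dual using approximate units of A only
(`IsLeftBiflat.exists_invariant`).

The link with G is the group character χ(y) = φ(L_y c), for which φ(f) = ∫ f χ. Multiplication by χ
turns m into a bounded translation invariant functional N on L^∞(G) with N(1) = 1. Its norm may
exceed one, but its total variation is additive, monotone and invariant, which keeps 1 at distance
at least one from the span of the f - L_y f; Hahn–Banach then gives a mean
(`isAmenable_of_invariant`).

Conversely, a mean M yields m(F) = M(y ↦ (F · c)(L_y c) χ(y⁻¹)). Invariance under points of G has to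
be upgraded to invariance under convolution; this is done by replacing convolution with a Bochner
integral of right translates in L¹(G) (`mean_twistedOrbit_conv`). -/

theorem charDual_apply (φ : characterSpace ℂ A) (a : A) : charDual φ a = φ a := rfl

theorem exists_char_eq_one (φ : characterSpace ℂ A) : ∃ a : A, φ a = 1 := by
  obtain ⟨a, ha⟩ : ∃ a : A, φ a ≠ 0 := by
    by_contra! h
    exact φ.2.1 (DFunLike.ext _ _ h)
  exact ⟨(φ a)⁻¹ • a, by rw [map_smul, smul_eq_mul, inv_mul_cancel₀ ha]⟩

/-- `A` is left `φ`-amenable: there is `m ∈ A**` with `a · m = φ(a) m` and `m(φ) = 1`. -/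
def IsLeftAmenable (φ : characterSpace ℂ A) : Prop :=
  ∃ m : Bidual A, (∀ (a : A) (f : StrongDual ℂ A), m (dualMulRight f a) = φ a * m f) ∧
    m (charDual φ) = 1

/-- Elementary tensors span a dense subspace of the completion. -/
theorem projTensor_ext {F : Type*} [NormedAddCommGroup F] [NormedSpace ℂ F]
    {S T : ProjTensor A →L[ℂ] F} (h : ∀ a b : A, S (ptmul a b) = T (ptmul a b)) : S = T := by
  ext x
  induction x using UniformSpace.Completion.induction_on with
  | hp => exact isClosed_eq S.continuous T.continuous
  | ih x =>
    induction x using PiTensorProduct.induction_on with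
    | smul_tprod r v =>
      have hv : v = ![v 0, v 1] := by funext i; fin_cases i <;> rfl
      have := h (v 0) (v 1)
      simp only [ptmul, ← hv] at this
      rw [UniformSpace.Completion.coe_smul, map_smul, map_smul, this]
    | add x y hx hy =>
      rw [UniformSpace.Completion.coe_add, map_add, map_add, hx, hy]

/-- The bounded operator `x ↦ x ⊗ b`. -/
def tmulRight (b : A) : A →L[ℂ] ProjTensor A :=
  UniformSpace.Completion.toComplL.comp <|
    (PiTensorProduct.tprodL ℂ (E := fun _ : Fin 2 => A)).toContinuousLinearMap ![0, b] 0

theorem tmulRight_apply (a b : A) : tmulRight b a = ptmul a b := by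
  have hv : Function.update ![0, b] 0 a = ![a, b] := by funext i; fin_cases i <;> rfl
  simp [tmulRight, ptmul, ContinuousMultilinearMap.toContinuousLinearMap, hv]

variable [CompleteSpace A]

theorem prodMor_leftAct (a : A) (x : ProjTensor A) :
    prodMor A (leftAct a x) = a * prodMor A x := by
  have : (prodMor A).comp (leftAct a) = (ContinuousLinearMap.mul ℂ A a).comp (prodMor A) :=
    projTensor_ext fun b c => by
      simp [leftAct_ptmul, prodMor_ptmul, mul_assoc]
  exact DFunLike.congr_fun this x

/-- The witness is ρ(a) = φ(a) (m ⊗ c) with φ(c) = 1, where m ⊗ c is the image of m under the second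
adjoint of x ↦ x ⊗ c. Invariance of m gives a · (m ⊗ c) = φ(a) (m ⊗ c). -/
theorem IsLeftAmenable.isLeftBiflat {φ : characterSpace ℂ A} (h : IsLeftAmenable φ) :
    IsLeftBiflat φ := by
  obtain ⟨m, hm, hm1⟩ := h
  obtain ⟨c, hc⟩ := exists_char_eq_one φ
  set M : Bidual (ProjTensor A) := bidualMap (tmulRight c) m with hM
  refine ⟨(charDual φ).smulRight M, fun a b => ?_, fun a b => ?_, fun a => ?_⟩
  · simp only [ContinuousLinearMap.smulRight_apply, charDual_apply, map_mul, smul_smul, mul_comm]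
  · have key : bidualMap (leftAct a) M = φ a • M := by
      ext f
      have : dualMap (tmulRight c) (dualMap (leftAct a) f) =
          dualMulRight (dualMap (tmulRight c) f) a := by
        ext x
        simp [dualMulRight_apply, tmulRight_apply, leftAct_ptmul]
      rw [bidualMap_apply, hM, bidualMap_apply, this, hm]
      rfl
    simp only [ContinuousLinearMap.smulRight_apply, charDual_apply, map_mul, map_smul, key,
      smul_smul, mul_comm]
  · have key : dualMap (tmulRight c) (dualMap (prodMor A) (charDual φ)) = charDual φ := by
      ext x
      simp [tmulRight_apply, prodMor_ptmul, charDual_apply, hc]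
    change φ a * m (dualMap (tmulRight c) (dualMap (prodMor A) (charDual φ))) = φ a
    rw [key, hm1, mul_one]

/-- Left `ψ`-biflatness of `B` gives a `φ`-invariant functional along a homomorphism `A → B`
carrying `ψ` to `φ`, provided that `A` has left approximate units. -/
theorem IsLeftBiflat.exists_invariant {B : Type*} [NonUnitalNormedRing B] [NormedSpace ℂ B]
    [IsScalarTower ℂ B B] [SMulCommClass ℂ B B] [CompleteSpace B]
    {ψ : characterSpace ℂ B} (h : IsLeftBiflat ψ) (φ : characterSpace ℂ A)
    (happ : ∀ b : A, b ∈ closure (Set.range fun e : A => e * b))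
    (j : A →L[ℂ] B) (hj : ∀ a b, j (a * b) = j a * j b) (hφ : ∀ a, ψ (j a) = φ a) :
    ∃ m : Bidual B, (∀ (a : A) (f : StrongDual ℂ B), m (dualMulRight f (j a)) = φ a * m f) ∧
      m (charDual ψ) = 1 := by
  obtain ⟨ρ, h1, h2, h3⟩ := h
  -- The kernel of ρ ∘ j is closed and contains every e b, because ρ(j(e b)) = φ(b) ρ(j e) = 0;
  -- approximate units then put b itself in it.
  have hker : ∀ b : A, φ b = 0 → ρ (j b) = 0 := by
    intro b hb
    have hcl : IsClosed {x : A | ρ (j x) = 0} :=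
      isClosed_eq (ρ.continuous.comp j.continuous) continuous_const
    refine closure_minimal ?_ hcl (happ b)
    rintro _ ⟨e, rfl⟩
    change ρ (j (e * b)) = 0
    rw [hj, h1, hφ, hb, zero_smul]
  obtain ⟨c, hc⟩ := exists_char_eq_one φ
  have hρ : ∀ a : A, ρ (j a) = φ a • ρ (j c) := by
    intro a
    rw [← sub_eq_zero, ← map_smul, ← map_smul, ← map_sub, ← map_sub]
    exact hker _ (by rw [map_sub, map_smul, hc, smul_eq_mul, mul_one, sub_self])
  refine ⟨bidualMap (prodMor B) (ρ (j c)), fun a f => ?_, ?_⟩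
  · have key : dualMap (prodMor B) (dualMulRight f (j a)) =
        dualMap (leftAct (j a)) (dualMap (prodMor B) f) := by
      ext x
      simp [dualMulRight_apply, prodMor_leftAct]
    rw [bidualMap_apply, key, ← bidualMap_apply (leftAct (j a)), ← h2, ← hj, hρ, map_mul, hc,
      mul_one]
    rfl
  · exact (h3 (j c)).trans ((hφ c).trans hc)

theorem IsLeftBiflat.isLeftAmenable {φ : characterSpace ℂ A} (h : IsLeftBiflat φ)
    (happ : ∀ b : A, b ∈ closure (Set.range fun e : A => e * b)) : IsLeftAmenable φ :=
  h.exists_invariant φ happ (ContinuousLinearMap.id ℂ A) (fun _ _ => rfl) fun _ => rfl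

/-- Along the canonical embedding A → A** one obtains an invariant functional in A****; restricting
it to A* ⊆ A*** gives the mean on A*. -/
theorem isLeftAmenable_of_isLeftBiflat_charExtend {φ : characterSpace ℂ A}
    (h : IsLeftBiflat (A := ArensBidual A) (charExtend φ))
    (happ : ∀ b : A, b ∈ closure (Set.range fun e : A => e * b)) : IsLeftAmenable φ := by
  obtain ⟨m, hm, hm1⟩ := h.exists_invariant φ happ
    (NormedSpace.inclusionInDoubleDual ℂ A : A →L[ℂ] Bidual A) (fun _ _ => rfl) fun _ => rfl
  exact ⟨dualMap (X := StrongDual ℂ A) (NormedSpace.inclusionInDoubleDual ℂ (StrongDual ℂ A)) m,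
    fun a f => hm a (NormedSpace.inclusionInDoubleDual ℂ (StrongDual ℂ A) f), hm1⟩

/-- Invariance of m says m · f = m(f) φ, whence F □ m = φ̃(F) m for every F ∈ A**; evaluation at m
is then the mean. -/
theorem IsLeftAmenable.charExtend {φ : characterSpace ℂ A} (h : IsLeftAmenable φ) :
    IsLeftAmenable (A := ArensBidual A) (charExtend φ) := by
  obtain ⟨(m : ArensBidual A), hm, hm1⟩ := h
  have key : ∀ F : ArensBidual A, F * m = LeftBiflat.charExtend φ F • m := by
    intro F
    refine ContinuousLinearMap.ext fun f => ?_
    have : ArensBidual.dualMulLeft m f = (show Bidual A from m) f • charDual φ :=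
      ContinuousLinearMap.ext fun a => (hm a f).trans (mul_comm _ _)
    change (show Bidual A from F) (ArensBidual.dualMulLeft m f) =
      (show Bidual A from F) (charDual φ) * (show Bidual A from m) f
    rw [this, map_smul, smul_eq_mul, mul_comm]
  refine ⟨NormedSpace.inclusionInDoubleDual ℂ (ArensBidual A) m, fun F f => ?_, hm1⟩
  change f (F * m) = LeftBiflat.charExtend φ F * f m
  rw [key, map_smul, smul_eq_mul]

end Abstract

end LeftBiflat

namespace LeftBiflat

/-! ### Approximate units of L¹(G) and the group character behind φ -/

section Group

variable {G : Type*} [Group G] [TopologicalSpace G] [IsTopologicalGroup G]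
  [MeasurableSpace G] [BorelSpace G]

theorem norm_translate {μ : Measure G} [μ.IsHaarMeasure] {p : ℝ≥0∞} (y : G) (f : Lp ℂ p μ) :
    ‖translate y f‖ = ‖f‖ := DomMulAct.norm_smul_Lp _ _

theorem translate_one {μ : Measure G} [μ.IsHaarMeasure] {p : ℝ≥0∞} (f : Lp ℂ p μ) :
    translate (1 : G) f = f := by
  rw [translate, inv_one, DomMulAct.mk_one, one_smul]

variable [LocallyCompactSpace G] [T2Space G] {μ : Measure G} [μ.IsHaarMeasure] [μ.Regular]

/-- `L¹(G)` has left approximate units. -/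
theorem mem_closure_range_conv (b : Lp ℂ 1 μ) :
    b ∈ closure (Set.range fun e : Lp ℂ 1 μ => conv μ e b) := by
  refine Metric.mem_closure_range_iff.2 fun ε hε => ?_
  have hU : {y : G | translate y b ∈ Metric.closedBall b (ε / 2)} ∈ nhds (1 : G) :=
    (continuous_translate μ b).continuousAt.preimage_mem_nhds
      (by rw [translate_one]; exact Metric.closedBall_mem_nhds b (half_pos hε))
  obtain ⟨K, hK1, hKU, hK⟩ := local_compact_nhds hU
  have h0 : μ K ≠ 0 := (Measure.measure_pos_of_mem_nhds μ hK1).ne'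
  have hKm := hK.isClosed.measurableSet
  -- Convolution with the normalised indicator of K averages the translates L_y b over K; these lie
  -- in a closed ball around b, which is convex.
  refine ⟨indicatorConstLp 1 hKm hK.measure_ne_top ((μ.real K)⁻¹ : ℂ), ?_⟩
  have hint : IntegrableOn (fun y => translate y b) K μ :=
    (continuous_translate μ b).continuousOn.integrableOn_compact hK
  have hmem : (⨍ y in K, translate y b ∂μ) ∈ Metric.closedBall b (ε / 2) :=
    (convex_closedBall b _).set_average_mem Metric.isClosed_closedBall h0 hK.measure_ne_top
      ((ae_restrict_iff' hKm).2 (.of_forall fun y hy => hKU hy)) hint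
  have heq : conv μ (indicatorConstLp 1 hKm hK.measure_ne_top ((μ.real K)⁻¹ : ℂ)) b =
      ⨍ y in K, translate y b ∂μ := by
    rw [setAverage_eq, ← integral_smul, ← integral_indicator hKm, conv]
    refine integral_congr_ae ?_
    filter_upwards [indicatorConstLp_coeFn (p := 1) (hs := hKm) (hμs := hK.measure_ne_top)
      (c := ((μ.real K)⁻¹ : ℂ))] with y hy
    rw [hy]
    by_cases hyK : y ∈ K
    · rw [Set.indicator_of_mem hyK, Set.indicator_of_mem hyK, ← Complex.ofReal_inv,
        Complex.coe_smul]
      rfl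
    · rw [Set.indicator_of_notMem hyK, Set.indicator_of_notMem hyK, zero_smul]
  rw [heq, dist_comm]
  exact (Metric.mem_closedBall.1 hmem).trans_lt (half_lt_self hε)

section Character

variable {φ : StrongDual ℂ (Lp ℂ 1 μ)} (hφ : ∀ f g, φ (conv μ f g) = φ f * φ g)
  {c : Lp ℂ 1 μ} (hc : φ c = 1)
include hφ hc

/-- The functional φ ∘ L_y vanishes on ker φ: if φ(g) = 0, then g is a limit of elements e * g, and
φ(L_y(e * g)) = φ(L_y e) φ(g) = 0. Hence it is a multiple of φ, with factor χ(y) = φ(L_y c). -/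
theorem char_translate (y : G) (f : Lp ℂ 1 μ) :
    φ (translate y f) = φ (translate y c) * φ f := by
  have hker : ∀ g : Lp ℂ 1 μ, φ g = 0 → φ (translateL μ y g) = 0 := by
    intro g hg
    have hcl : IsClosed {g : Lp ℂ 1 μ | φ (translateL μ y g) = 0} :=
      isClosed_eq (φ.continuous.comp (translateL μ y).continuous) continuous_const
    refine closure_minimal ?_ hcl (mem_closure_range_conv g)
    rintro _ ⟨e, rfl⟩
    change φ (translate y (conv μ e g)) = 0
    rw [translate_conv, hφ, hg, mul_zero]
  have := hker (f - φ f • c) (by rw [map_sub, map_smul, hc, smul_eq_mul, mul_one, sub_self])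
  rw [map_sub, map_smul, map_sub, map_smul, sub_eq_zero, translateL_apply, translateL_apply,
    smul_eq_mul] at this
  rw [this, mul_comm]

theorem char_translate_mul (y z : G) :
    φ (translate (y * z) c) = φ (translate y c) * φ (translate z c) := by
  rw [← translate_translate, char_translate hφ hc]

theorem char_translate_mul_inv (y : G) :
    φ (translate y c) * φ (translate y⁻¹ c) = 1 := by
  rw [← char_translate_mul hφ hc, mul_inv_cancel, translate_one, hc]

/-- Apply φ to the Bochner integral f * c = ∫ f(y) L_y c dy. -/
theorem char_eq_integral (f : Lp ℂ 1 μ) : φ f = ∫ y, f y * φ (translate y c) ∂μ := by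
  have h : φ (conv μ f c) = ∫ y, φ (f y • translate y c) ∂μ :=
    (ContinuousLinearMap.integral_comp_comm φ (integrable_conv μ f c)).symm
  rw [hφ, hc, mul_one] at h
  rw [h]
  simp only [map_smul, smul_eq_mul]

end Character

theorem continuous_char_translate (φ : StrongDual ℂ (Lp ℂ 1 μ)) (c : Lp ℂ 1 μ) :
    Continuous fun y : G => φ (translate y c) :=
  φ.continuous.comp (continuous_translate μ c)

theorem norm_char_translate_le (φ : StrongDual ℂ (Lp ℂ 1 μ)) (c : Lp ℂ 1 μ) (y : G) :
    ‖φ (translate y c)‖ ≤ ‖φ‖ * ‖c‖ :=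
  (φ.le_opNorm _).trans_eq (by rw [norm_translate])

end Group

end LeftBiflat

namespace LeftBiflat

/-! ### Total variation of a bounded functional on L^∞ -/

section Linfty

variable {X : Type*} [MeasurableSpace X] {μ : Measure X}

theorem norm_le_of_ae_bound_top {f : Lp ℂ ∞ μ} {C : ℝ} (hC : 0 ≤ C) (h : ∀ᵐ x ∂μ, ‖f x‖ ≤ C) :
    ‖f‖ ≤ C := by
  rw [Lp.norm_def, eLpNorm_exponent_top]
  exact ENNReal.toReal_le_of_le_ofReal hC (eLpNormEssSup_le_of_ae_bound h)

theorem ae_norm_le_norm_top (f : Lp ℂ ∞ μ) : ∀ᵐ x ∂μ, ‖f x‖ ≤ ‖f‖ := by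
  filter_upwards [enorm_ae_le_eLpNormEssSup f μ] with x hx
  rw [Lp.norm_def, eLpNorm_exponent_top, ← toReal_enorm]
  refine ENNReal.toReal_mono ?_ hx
  rw [← eLpNorm_exponent_top]
  exact Lp.eLpNorm_ne_top f

variable (N : StrongDual ℂ (Lp ℂ ∞ μ))

/-- The total variation of `N` at `u`: the supremum of `‖N g‖` over `|g| ≤ u`. -/
def variationAt (u : X → ℝ) : ℝ :=
  sSup {r | ∃ g : Lp ℂ ∞ μ, (∀ᵐ x ∂μ, ‖g x‖ ≤ u x) ∧ ‖N g‖ = r}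

/-- A measurable function that is nonnegative and bounded almost everywhere. -/
def IsNonnegBounded (μ : Measure X) (u : X → ℝ) : Prop :=
  AEStronglyMeasurable u μ ∧ (∀ᵐ x ∂μ, 0 ≤ u x) ∧ ∃ C, ∀ᵐ x ∂μ, u x ≤ C

theorem IsNonnegBounded.add {u v : X → ℝ} (hu : IsNonnegBounded μ u) (hv : IsNonnegBounded μ v) :
    IsNonnegBounded μ (fun x => u x + v x) := by
  obtain ⟨hu1, hu2, C, hC⟩ := hu
  obtain ⟨hv1, hv2, D, hD⟩ := hv
  refine ⟨hu1.add hv1, ?_, C + D, ?_⟩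
  · filter_upwards [hu2, hv2] with x h1 h2 using add_nonneg h1 h2
  · filter_upwards [hC, hD] with x h1 h2 using add_le_add h1 h2

theorem isNonnegBounded_const {r : ℝ} (hr : 0 ≤ r) : IsNonnegBounded μ fun _ => r :=
  ⟨aestronglyMeasurable_const, .of_forall fun _ => hr, r, .of_forall fun _ => le_rfl⟩

theorem isNonnegBounded_re_add_norm (f : Lp ℂ ∞ μ) :
    IsNonnegBounded μ fun x => (f x).re + ‖f‖ := by
  refine ⟨?_, ?_, ‖f‖ + ‖f‖, ?_⟩
  · exact (Complex.continuous_re.comp_aestronglyMeasurable (Lp.aestronglyMeasurable f)).add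
      aestronglyMeasurable_const
  · filter_upwards [ae_norm_le_norm_top f] with x hx
    linarith [neg_le_of_abs_le ((Complex.abs_re_le_norm (f x)).trans hx)]
  · filter_upwards [ae_norm_le_norm_top f] with x hx
    linarith [le_of_abs_le ((Complex.abs_re_le_norm (f x)).trans hx)]

variable {N}

theorem bddAbove_variationAt {u : X → ℝ} (hu : IsNonnegBounded μ u) :
    BddAbove {r | ∃ g : Lp ℂ ∞ μ, (∀ᵐ x ∂μ, ‖g x‖ ≤ u x) ∧ ‖N g‖ = r} := by
  obtain ⟨-, -, C, hC⟩ := hu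
  refine ⟨‖N‖ * max C 0, ?_⟩
  rintro _ ⟨g, hg, rfl⟩
  refine (N.le_opNorm g).trans (mul_le_mul_of_nonneg_left ?_ (norm_nonneg _))
  refine norm_le_of_ae_bound_top (le_max_right _ _) ?_
  filter_upwards [hg, hC] with x h1 h2 using (h1.trans h2).trans (le_max_left _ _)

theorem le_variationAt {u : X → ℝ} (hu : IsNonnegBounded μ u) {g : Lp ℂ ∞ μ}
    (hg : ∀ᵐ x ∂μ, ‖g x‖ ≤ u x) : ‖N g‖ ≤ variationAt N u :=
  le_csSup (bddAbove_variationAt hu) ⟨g, hg, rfl⟩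

theorem variationAt_le {u : X → ℝ} (hu : IsNonnegBounded μ u) {r : ℝ}
    (h : ∀ g : Lp ℂ ∞ μ, (∀ᵐ x ∂μ, ‖g x‖ ≤ u x) → ‖N g‖ ≤ r) : variationAt N u ≤ r := by
  refine csSup_le ⟨_, 0, ?_, rfl⟩ ?_
  · filter_upwards [hu.2.1, Lp.coeFn_zero ℂ ∞ μ] with x h1 h2
    rwa [h2, Pi.zero_apply, norm_zero]
  · rintro _ ⟨g, hg, rfl⟩
    exact h g hg

theorem variationAt_mono {u v : X → ℝ} (hu : IsNonnegBounded μ u) (hv : IsNonnegBounded μ v)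
    (h : ∀ᵐ x ∂μ, u x ≤ v x) : variationAt N u ≤ variationAt N v :=
  variationAt_le hu fun g hg => le_variationAt hv <| by
    filter_upwards [hg, h] with x h1 h2 using h1.trans h2

theorem variationAt_congr {u v : X → ℝ} (h : u =ᵐ[μ] v) : variationAt N u = variationAt N v := by
  have h' (g : Lp ℂ ∞ μ) : (∀ᵐ x ∂μ, ‖g x‖ ≤ u x) ↔ ∀ᵐ x ∂μ, ‖g x‖ ≤ v x :=
    Filter.eventually_congr (h.mono fun x hx => by rw [hx])
  simp only [variationAt, h']

theorem exists_norm_one_mul (z : ℂ) : ∃ w : ℂ, ‖w‖ = 1 ∧ w * z = ‖z‖ := by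
  by_cases hz : z = 0
  · exact ⟨1, norm_one, by simp [hz]⟩
  · have h : (‖z‖ : ℂ) ≠ 0 := by simpa using hz
    refine ⟨‖z‖ / z, by simp [hz], by field_simp⟩

/-- For ≤, a function g with |g| ≤ u + v is divided in the proportion u : v. For ≥, near-optimal
functions for u and v are rotated by unimodular constants so that the values of N add without
cancellation. -/
theorem variationAt_add {u v : X → ℝ} (hu : IsNonnegBounded μ u) (hv : IsNonnegBounded μ v) :
    variationAt N (fun x => u x + v x) = variationAt N u + variationAt N v := by
  apply le_antisymm
  · refine variationAt_le (hu.add hv) fun g hg => ?_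
    have hquot : AEStronglyMeasurable (fun x => ((u x / (u x + v x) : ℝ) : ℂ)) μ :=
      Complex.continuous_ofReal.comp_aestronglyMeasurable
        (hu.1.aemeasurable.div (hu.add hv).1.aemeasurable).aestronglyMeasurable
    have hb : ∀ᵐ x ∂μ, ‖g x * ((u x / (u x + v x) : ℝ) : ℂ)‖ ≤ u x ∧
        ‖g x - g x * ((u x / (u x + v x) : ℝ) : ℂ)‖ ≤ v x := by
      filter_upwards [hg, hu.2.1, hv.2.1] with x h1 h2 h3
      -- Where u + v = 0 the quotient is 0 by convention, which is harmless because g vanishes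
      -- there.
      rcases (add_nonneg h2 h3).eq_or_lt with h0 | h0
      · rw [← h0] at h1
        have : g x = 0 := norm_le_zero_iff.1 h1
        simp [this, h2, h3]
      · have e : g x - g x * ((u x / (u x + v x) : ℝ) : ℂ) =
            g x * ((v x / (u x + v x) : ℝ) : ℂ) := by
          have : ((v x / (u x + v x) : ℝ) : ℂ) = ((1 - u x / (u x + v x) : ℝ) : ℂ) := by
            congr 1; field_simp; ring
          rw [this]; push_cast; ring
        rw [e, norm_mul, norm_mul, Complex.norm_of_nonneg (div_nonneg h2 h0.le),
          Complex.norm_of_nonneg (div_nonneg h3 h0.le)]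
        constructor
        · refine (mul_le_mul_of_nonneg_right h1 (div_nonneg h2 h0.le)).trans_eq ?_
          field_simp
        · refine (mul_le_mul_of_nonneg_right h1 (div_nonneg h3 h0.le)).trans_eq ?_
          field_simp
    obtain ⟨C, hC⟩ := hu.2.2
    have hmem : MemLp (fun x => g x * ((u x / (u x + v x) : ℝ) : ℂ)) ∞ μ :=
      memLp_top_of_bound ((Lp.aestronglyMeasurable g).mul hquot) C <| by
        filter_upwards [hb, hC] with x h1 h2 using h1.1.trans h2
    have h1 : ‖N hmem.toLp‖ ≤ variationAt N u := le_variationAt hu <| by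
      filter_upwards [hb, hmem.coeFn_toLp] with x h1 h2
      rw [h2]; exact h1.1
    have h2 : ‖N (g - hmem.toLp)‖ ≤ variationAt N v := le_variationAt hv <| by
      filter_upwards [hb, hmem.coeFn_toLp, Lp.coeFn_sub g hmem.toLp] with x h1 h2 h3
      rw [h3, Pi.sub_apply, h2]; exact h1.2
    calc ‖N g‖ = ‖N hmem.toLp + N (g - hmem.toLp)‖ := by rw [← map_add, add_sub_cancel]
      _ ≤ _ := (norm_add_le _ _).trans (add_le_add h1 h2)
  · rw [← le_sub_iff_add_le]
    refine variationAt_le hu fun g hg => ?_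
    rw [le_sub_iff_add_le, ← le_sub_iff_add_le']
    refine variationAt_le hv fun h hh => ?_
    rw [le_sub_iff_add_le']
    obtain ⟨w, hw, hwg⟩ := exists_norm_one_mul (N g)
    obtain ⟨z, hz, hzh⟩ := exists_norm_one_mul (N h)
    have key : ‖N (w • g + z • h)‖ = ‖N g‖ + ‖N h‖ := by
      rw [map_add, map_smul, map_smul, smul_eq_mul, smul_eq_mul, hwg, hzh, ← Complex.ofReal_add,
        Complex.norm_of_nonneg (by positivity)]
    rw [← key]
    refine le_variationAt (hu.add hv) ?_
    filter_upwards [hg, hh, Lp.coeFn_add (w • g) (z • h), Lp.coeFn_smul w g, Lp.coeFn_smul z h]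
      with x h1 h2 h3 h4 h5
    rw [h3, Pi.add_apply, h4, h5]
    refine (norm_add_le _ _).trans (add_le_add ?_ ?_)
    · rwa [Pi.smul_apply, norm_smul, hw, one_mul]
    · rwa [Pi.smul_apply, norm_smul, hz, one_mul]

variable (N) in
/-- The total variation of `N`, extended additively from nonnegative functions to the real parts
of elements of `L^∞`. -/
def variationRe (f : Lp ℂ ∞ μ) : ℝ :=
  variationAt N (fun x => (f x).re + ‖f‖) - variationAt N fun _ => ‖f‖

/-- After moving the shifts by norms to the appropriate sides, both sides evaluate the variation at
the same nonnegative function, and `variationAt_add` splits it in two ways. -/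
theorem variationRe_add (f g : Lp ℂ ∞ μ) :
    variationRe N (f + g) = variationRe N f + variationRe N g := by
  have hf := isNonnegBounded_re_add_norm f
  have hg := isNonnegBounded_re_add_norm g
  have hfg := isNonnegBounded_re_add_norm (f + g)
  have cf := isNonnegBounded_const (μ := μ) (norm_nonneg f)
  have cg := isNonnegBounded_const (μ := μ) (norm_nonneg g)
  have cfg := isNonnegBounded_const (μ := μ) (norm_nonneg (f + g))
  have h : variationAt N (fun x => ((f + g : Lp ℂ ∞ μ) x).re + ‖f + g‖ + (‖f‖ + ‖g‖)) =
      variationAt N (fun x => ((f x).re + ‖f‖) + ((g x).re + ‖g‖) + ‖f + g‖) := by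
    refine variationAt_congr ?_
    filter_upwards [Lp.coeFn_add f g] with x hx
    rw [hx, Pi.add_apply, Complex.add_re]
    ring
  rw [variationAt_add hfg (cf.add cg), variationAt_add cf cg, variationAt_add (hf.add hg) cfg,
    variationAt_add hf hg] at h
  unfold variationRe
  linarith

theorem variationRe_neg (f : Lp ℂ ∞ μ) : variationRe N (-f) = -variationRe N f := by
  have h0 : variationRe N 0 = 0 := by
    have := variationRe_add (N := N) 0 0
    rw [add_zero] at this
    linarith
  have := variationRe_add (N := N) f (-f)
  rw [add_neg_cancel, h0] at this
  linarith

/-- Strict positivity in quantitative form: Re f + ‖f‖ dominates ε + ‖f‖, and the contribution of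
‖f‖ cancels by additivity. -/
theorem norm_le_variationRe {f : Lp ℂ ∞ μ} {ε : ℝ} (hε : 0 ≤ ε) (hf : ∀ᵐ x ∂μ, ε ≤ (f x).re) :
    ‖N ((memLp_top_const (ε : ℂ)).toLp)‖ ≤ variationRe N f := by
  have cf := isNonnegBounded_const (μ := μ) (norm_nonneg f)
  have ce := isNonnegBounded_const (μ := μ) hε
  have h1 : variationAt N (fun _ => ε + ‖f‖) ≤ variationAt N (fun x => (f x).re + ‖f‖) :=
    variationAt_mono (ce.add cf) (isNonnegBounded_re_add_norm f) <| by
      filter_upwards [hf] with x hx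
      linarith
  rw [variationAt_add ce cf] at h1
  have h2 : ‖N ((memLp_top_const (ε : ℂ)).toLp)‖ ≤ variationAt N fun _ => ε :=
    le_variationAt ce <| by
      filter_upwards [(memLp_top_const (μ := μ) (ε : ℂ)).coeFn_toLp] with x hx
      rw [hx, Complex.norm_of_nonneg hε]
  unfold variationRe
  linarith

end Linfty

end LeftBiflat

namespace LeftBiflat

/-! ### From an invariant functional to an invariant mean -/

section InvariantMean

variable {G : Type*} [Group G] [TopologicalSpace G] [IsTopologicalGroup G]
  [MeasurableSpace G] [BorelSpace G] {μ : Measure G} [μ.IsHaarMeasure]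

theorem translate_smul (y : G) (r : ℂ) (f : Lp ℂ ∞ μ) :
    translate y (r • f) = r • translate y f := smul_comm (DomMulAct.mk y⁻¹) r f

variable {N : StrongDual ℂ (Lp ℂ ∞ μ)} (hN : ∀ (y : G) (f : Lp ℂ ∞ μ), N (translate y f) = N f)
include hN

theorem variationAt_translate (y : G) (u : G → ℝ) :
    variationAt N (fun x => u (y⁻¹ * x)) = variationAt N u := by
  unfold variationAt
  congr 1
  ext r
  constructor
  · rintro ⟨g, hg, rfl⟩
    refine ⟨translate y⁻¹ g, ?_, by rw [hN]⟩
    filter_upwards [(eventually_mul_left_iff μ y).2 hg, translate_ae_eq y⁻¹ g] with x h1 h2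
    rw [h2, inv_inv]
    simpa using h1
  · rintro ⟨g, hg, rfl⟩
    refine ⟨translate y g, ?_, by rw [hN]⟩
    filter_upwards [(eventually_mul_left_iff μ y⁻¹).2 hg, translate_ae_eq y g] with x h1 h2
    rwa [h2]

theorem variationRe_translate (y : G) (f : Lp ℂ ∞ μ) :
    variationRe N (translate y f) = variationRe N f := by
  unfold variationRe
  rw [norm_translate, ← variationAt_translate hN y fun x => (f x).re + ‖f‖]
  congr 1
  refine variationAt_congr ?_
  filter_upwards [translate_ae_eq y f] with x hx
  rw [hx]

/-- The elements of the span of the `f - L_y f` stay at distance at least one from the constant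
function one. -/
theorem one_le_norm_one_sub_of_mem_span
    (h1 : N ((memLp_top_const (1 : ℂ)).toLp (fun _ : G => (1 : ℂ))) = 1) {k : Lp ℂ ∞ μ}
    (hk : k ∈ Submodule.span ℂ {k | ∃ (y : G) (f : Lp ℂ ∞ μ), k = f - translate y f}) :
    1 ≤ ‖(memLp_top_const (1 : ℂ)).toLp (fun _ : G => (1 : ℂ)) - k‖ := by
  -- The span is complex but `variationRe` is only additive, so the induction carries an arbitrary
  -- scalar r.
  have hz : ∀ r : ℂ, variationRe N (r • k) = 0 := by
    induction hk using Submodule.span_induction with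
    | mem k hk =>
      obtain ⟨y, f, rfl⟩ := hk
      intro r
      rw [smul_sub, ← translate_smul, sub_eq_add_neg, variationRe_add, variationRe_neg,
        variationRe_translate hN, add_neg_cancel]
    | zero =>
      intro r
      have := variationRe_add (N := N) 0 0
      rw [add_zero] at this
      rw [smul_zero]
      linarith
    | add k l _ _ hk hl =>
      intro r
      rw [smul_add, variationRe_add, hk, hl, add_zero]
    | smul s k _ hk =>
      intro r
      rw [smul_smul]
      exact hk _
  by_contra! hlt
  set e := (memLp_top_const (1 : ℂ)).toLp (fun _ : G => (1 : ℂ)) with he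
  -- If ‖1 - k‖ < 1, then Re k ≥ ε = 1 - ‖1 - k‖ > 0, so the variation at k is at least |N(ε)| = ε,
  -- contradicting its vanishing on the span.
  have hε : 0 < 1 - ‖e - k‖ := by linarith
  have hre : ∀ᵐ x ∂μ, 1 - ‖e - k‖ ≤ (k x).re := by
    filter_upwards [ae_norm_le_norm_top (e - k), Lp.coeFn_sub e k,
      (memLp_top_const (μ := μ) (1 : ℂ)).coeFn_toLp] with x h1 h2 h3
    rw [h2, Pi.sub_apply, he, h3] at h1
    have := le_of_abs_le ((Complex.abs_re_le_norm _).trans h1)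
    rw [Complex.sub_re, Complex.one_re] at this
    linarith
  have hle := norm_le_variationRe (N := N) hε.le hre
  have hsm : (memLp_top_const (((1 - ‖e - k‖ : ℝ)) : ℂ)).toLp (fun _ : G => _) =
      (((1 - ‖e - k‖ : ℝ)) : ℂ) • e := by
    refine Lp.ext ?_
    filter_upwards [(memLp_top_const (μ := μ) (((1 - ‖e - k‖ : ℝ)) : ℂ)).coeFn_toLp,
      (memLp_top_const (μ := μ) (1 : ℂ)).coeFn_toLp,
      Lp.coeFn_smul (((1 - ‖e - k‖ : ℝ)) : ℂ) e] with x h1 h2 h3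
    rw [h1, h3, Pi.smul_apply, he, h2, smul_eq_mul, mul_one]
  have hz1 := hz 1
  rw [one_smul] at hz1
  rw [hsm, hz1, map_smul, h1, smul_eq_mul, mul_one, Complex.norm_of_nonneg hε.le] at hle
  linarith

/-- A bounded translation invariant functional on `L^∞(G)` that does not vanish at the constant
function one yields an invariant mean. -/
theorem isAmenable_of_invariant
    (h1 : N ((memLp_top_const (1 : ℂ)).toLp (fun _ : G => (1 : ℂ))) = 1) : IsAmenable μ := by
  set e := (memLp_top_const (1 : ℂ)).toLp (fun _ : G => (1 : ℂ)) with he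
  set D := Submodule.span ℂ {k | ∃ (y : G) (f : Lp ℂ ∞ μ), k = f - translate y f}
  have hnorm : ‖e‖ ≤ 1 := norm_le_of_ae_bound_top zero_le_one <| by
    filter_upwards [(memLp_top_const (μ := μ) (1 : ℂ)).coeFn_toLp] with x hx
    rw [he, hx, norm_one]
  have hq : ‖(Submodule.Quotient.mk e : Lp ℂ ∞ μ ⧸ D)‖ = 1 := by
    refine le_antisymm ((Submodule.Quotient.norm_mk_le D e).trans hnorm) ?_
    by_contra! hlt
    obtain ⟨m, hm, hm1⟩ := Submodule.Quotient.norm_mk_lt (S := D) (Submodule.Quotient.mk e)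
      (sub_pos.2 hlt)
    rw [add_sub_cancel] at hm1
    have hmem : e - m ∈ D := (Submodule.Quotient.eq D).1 hm.symm
    have := one_le_norm_one_sub_of_mem_span hN h1 hmem
    rw [← he, sub_sub_cancel] at this
    linarith
  -- A norming functional for the class of 1 in the quotient by D is invariant once pulled back, and
  -- has norm one since that class has norm one.
  obtain ⟨g, hg, hge⟩ := exists_dual_vector ℂ (Submodule.Quotient.mk e : Lp ℂ ∞ μ ⧸ D)
    (by rw [hq]; exact one_ne_zero)
  set M : StrongDual ℂ (Lp ℂ ∞ μ) :=
    LinearMap.mkContinuous (g.toLinearMap.comp D.mkQ) 1 fun f => by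
      refine (g.le_opNorm _).trans ?_
      rw [hg]
      exact mul_le_mul_of_nonneg_left (Submodule.Quotient.norm_mk_le D f) zero_le_one
  have hMe : M e = 1 := by
    change g (Submodule.Quotient.mk e) = 1
    rw [hge, hq]
    exact Complex.ofReal_one
  refine ⟨M, le_antisymm (LinearMap.mkContinuous_norm_le _ zero_le_one _) ?_, hMe, fun y f => ?_⟩
  · have := M.le_opNorm e
    rw [hMe, norm_one] at this
    exact this.trans (mul_le_of_le_one_right (norm_nonneg _) hnorm)
  · change g (Submodule.Quotient.mk _) = g (Submodule.Quotient.mk _)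
    congr 1
    exact ((Submodule.Quotient.eq D).2 (Submodule.subset_span ⟨y, f, rfl⟩)).symm

end InvariantMean

/-! ### Left φ-amenability of L¹(G) implies amenability of G -/

section AmenableOfLeftAmenable

variable {G : Type*} [Group G] [TopologicalSpace G] [IsTopologicalGroup G]
  [MeasurableSpace G] [BorelSpace G] [LocallyCompactSpace G] [T2Space G]
  {μ : Measure G} [μ.IsHaarMeasure] [μ.Regular]

theorem integrable_mul_mul_char (φ : StrongDual ℂ (Lp ℂ 1 μ)) (c : Lp ℂ 1 μ) (f : Lp ℂ ∞ μ)
    (a : Lp ℂ 1 μ) : Integrable (fun x => a x * (f x * φ (translate x c))) μ := by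
  refine (L1.integrable_coeFn a).mul_bdd (c := ‖f‖ * (‖φ‖ * ‖c‖))
    ((Lp.aestronglyMeasurable f).mul (continuous_char_translate φ c).aestronglyMeasurable) ?_
  filter_upwards [ae_norm_le_norm_top f] with x hx
  rw [norm_mul]
  exact mul_le_mul hx (norm_char_translate_le φ c x) (norm_nonneg _) (norm_nonneg _)

/-- The pairing `(f, a) ↦ ∫ a f χ` of `L^∞(G)` and `L¹(G)`, twisted by `χ(x) = φ(L_x c)`. -/
def twistedPairing (φ : StrongDual ℂ (Lp ℂ 1 μ)) (c : Lp ℂ 1 μ) :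
    Lp ℂ ∞ μ →L[ℂ] StrongDual ℂ (Lp ℂ 1 μ) :=
  LinearMap.mkContinuous₂
    (LinearMap.mk₂ ℂ (fun f a => ∫ x, a x * (f x * φ (translate x c)) ∂μ)
      (fun f g a => by
        rw [← integral_add (integrable_mul_mul_char φ c f a) (integrable_mul_mul_char φ c g a)]
        refine integral_congr_ae ?_
        filter_upwards [Lp.coeFn_add f g] with x hx
        rw [hx, Pi.add_apply]; ring)
      (fun r f a => by
        rw [← integral_smul]
        refine integral_congr_ae ?_
        filter_upwards [Lp.coeFn_smul r f] with x hx
        rw [hx, Pi.smul_apply, smul_eq_mul, smul_eq_mul]; ring)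
      (fun f a b => by
        rw [← integral_add (integrable_mul_mul_char φ c f a) (integrable_mul_mul_char φ c f b)]
        refine integral_congr_ae ?_
        filter_upwards [Lp.coeFn_add a b] with x hx
        rw [hx, Pi.add_apply]; ring)
      (fun r f a => by
        rw [← integral_smul]
        refine integral_congr_ae ?_
        filter_upwards [Lp.coeFn_smul r a] with x hx
        rw [hx, Pi.smul_apply, smul_eq_mul, smul_eq_mul]; ring)) (‖φ‖ * ‖c‖)
    fun f a => by
      refine (norm_integral_le_integral_norm _).trans ?_
      rw [L1.norm_eq_integral_norm a, ← integral_const_mul]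
      refine integral_mono_ae (integrable_mul_mul_char φ c f a).norm
        ((L1.integrable_coeFn a).norm.const_mul _) ?_
      filter_upwards [ae_norm_le_norm_top f] with x hx
      rw [norm_mul, norm_mul, mul_comm, mul_comm ‖f x‖]
      gcongr
      exact norm_char_translate_le φ c x

theorem twistedPairing_apply (φ : StrongDual ℂ (Lp ℂ 1 μ)) (c : Lp ℂ 1 μ) (f : Lp ℂ ∞ μ)
    (a : Lp ℂ 1 μ) : twistedPairing φ c f a = ∫ x, a x * (f x * φ (translate x c)) ∂μ := rfl

variable {φ : StrongDual ℂ (Lp ℂ 1 μ)} (hφ : ∀ f g, φ (conv μ f g) = φ f * φ g)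
  {c : Lp ℂ 1 μ} (hc : φ c = 1)
include hφ hc

/-- Substitute x ↦ y x and use χ(y x) = χ(y) χ(x). -/
theorem twistedPairing_translate (y : G) (f : Lp ℂ ∞ μ) :
    twistedPairing φ c (translate y f) =
      φ (translate y c) • dualMap (translateL μ y⁻¹) (twistedPairing φ c f) := by
  ext a
  rw [_root_.smul_apply, dualMap_apply, translateL_apply, twistedPairing_apply,
    twistedPairing_apply,
    ← integral_mul_left_eq_self (fun x => a x * (translate y f x * φ (translate x c))) y,
    ← integral_smul]
  refine integral_congr_ae ?_
  filter_upwards [(eventually_mul_left_iff μ y).2 (translate_ae_eq y f),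
    translate_ae_eq y⁻¹ a] with x h1 h2
  rw [h1, h2, inv_inv, inv_mul_cancel_left, char_translate_mul hφ hc, smul_eq_mul]
  ring

theorem twistedPairing_one :
    twistedPairing φ c ((memLp_top_const (1 : ℂ)).toLp (fun _ : G => (1 : ℂ))) = φ := by
  ext a
  rw [twistedPairing_apply, char_eq_integral hφ hc]
  refine integral_congr_ae ?_
  filter_upwards [(memLp_top_const (μ := μ) (1 : ℂ)).coeFn_toLp] with x hx
  rw [hx, one_mul]

/-- Since L_y(c * x) = (L_y c) * x, the functionals (f ∘ L_y) · c and f · (L_y c) agree; evaluate m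
on both. -/
theorem invariant_dualMap_translateL {m : Bidual (Lp ℂ 1 μ)}
    (hm : ∀ a f, m (arensAdjoint (convL μ) f a) = φ a * m f) (y : G)
    (f : StrongDual ℂ (Lp ℂ 1 μ)) :
    m (dualMap (translateL μ y) f) = φ (translate y c) * m f := by
  have h : arensAdjoint (convL μ) (dualMap (translateL μ y) f) c =
      arensAdjoint (convL μ) f (translate y c) := by
    ext x
    simp only [arensAdjoint_apply, dualMap_apply, translateL_apply, convL_apply, translate_conv]
  have := hm c (dualMap (translateL μ y) f)
  rwa [h, hm, hc, one_mul, eq_comm] at this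

/-- In m composed with the twisted pairing, the factor χ(y) from the pairing cancels the factor
χ(y⁻¹) from m. -/
theorem isAmenable_of_invariant_bidual {m : Bidual (Lp ℂ 1 μ)}
    (hm : ∀ a f, m (arensAdjoint (convL μ) f a) = φ a * m f) (hm1 : m φ = 1) : IsAmenable μ := by
  refine isAmenable_of_invariant (N := m.comp (twistedPairing φ c)) (fun y f => ?_) ?_
  · rw [ContinuousLinearMap.comp_apply, twistedPairing_translate hφ hc, map_smul,
      invariant_dualMap_translateL hφ hc hm, smul_eq_mul, ← mul_assoc,
      char_translate_mul_inv hφ hc, one_mul, ContinuousLinearMap.comp_apply]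
  · rw [ContinuousLinearMap.comp_apply, twistedPairing_one hφ hc, hm1]

end AmenableOfLeftAmenable

end LeftBiflat

namespace LeftBiflat

/-! ### The modular function and right translates in L¹(G) -/

section RightTranslation

open scoped Pointwise

variable {G : Type*} [Group G] [TopologicalSpace G] [IsTopologicalGroup G]
  [MeasurableSpace G] [BorelSpace G] [LocallyCompactSpace G] [T2Space G]
  {μ : Measure G} [μ.IsHaarMeasure] [μ.Regular]

theorem integral_mul_right_eq {E : Type*} [NormedAddCommGroup E] [NormedSpace ℝ E]
    (z : G) (f : G → E) :
    ∫ x, f (x * z) ∂μ = (Measure.modularCharacterFun z : ℝ) • ∫ x, f x ∂μ := by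
  have hreg : (Measure.map (· * z) μ).Regular := Measure.Regular.map (Homeomorph.mulRight z)
  have h : Measure.map (· * z) μ = Measure.modularCharacterFun z • μ := by
    rw [Measure.modularCharacterFun_eq_haarScalarFactor μ]
    exact Measure.isMulLeftInvariant_eq_smul_of_regular _ μ
  have h2 := (MeasurableEquiv.mulRight z).measurableEmbedding.integral_map (μ := μ) f
  rw [MeasurableEquiv.coe_mulRight] at h2
  rw [← h2, h, integral_smul_nnreal_measure]
  rfl

/-- The modular function is the ratio of ∫ f(x z) dx to ∫ f for a fixed bump function f; near a
point, all the integrands are supported in one compact set. -/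
theorem continuous_modularCharacterFun :
    Continuous fun z : G => (Measure.modularCharacterFun z : ℝ) := by
  obtain ⟨⟨f, hf⟩, hsupp, hnonneg, hone⟩ :
    ∃ f : C(G, ℝ), HasCompactSupport f ∧ 0 ≤ f ∧ f 1 ≠ 0 := exists_continuous_nonneg_pos 1
  set ν : Measure G := Measure.haar
  have hint : ∫ x, f x ∂ν ≠ 0 :=
    (hf.integral_pos_of_hasCompactSupport_nonneg_nonzero hsupp hnonneg hone).ne'
  have heq : ∀ z, (Measure.modularCharacterFun z : ℝ) = (∫ x, f (x * z) ∂ν) / ∫ x, f x ∂ν :=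
    fun z => by rw [integral_mul_right_eq, smul_eq_mul, mul_div_cancel_right₀ _ hint]
  simp only [heq]
  refine Continuous.div_const (continuous_iff_continuousAt.2 fun z₀ => ?_) _
  obtain ⟨K, hK, hK0⟩ := exists_compact_mem_nhds z₀
  have hcont : ContinuousOn (fun z => ∫ x, f (x * z) ∂ν) K := by
    refine continuousOn_integral_of_compact_support (k := tsupport f * K⁻¹)
      (hsupp.isCompact.mul hK.inv)
      (hf.comp (continuous_snd.mul continuous_fst)).continuousOn fun z x hz hx => ?_
    exact image_eq_zero_of_notMem_tsupport fun h =>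
      hx ⟨_, h, z⁻¹, Set.inv_mem_inv.2 hz, mul_inv_cancel_right x z⟩
  exact hcont.continuousAt hK0

/-- The right translate `x ↦ δ(z) a(x z⁻¹)` of a function `a`, where `δ(z)` is the factor by which
right translation by `z` changes the Haar measure. -/
def rightTranslate (a : G → ℂ) (z x : G) : ℂ :=
  (Measure.modularCharacterFun z : ℝ) • a (x * z⁻¹)

variable {a : G → ℂ} (ha : Continuous a) (hsupp : HasCompactSupport a)
include ha

theorem continuous_rightTranslate :
    Continuous (Function.uncurry (rightTranslate a)) :=
  (continuous_modularCharacterFun.comp continuous_fst).smul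
    (ha.comp (continuous_snd.mul continuous_fst.inv))

include hsupp

theorem integrable_rightTranslate (z : G) : Integrable (rightTranslate a z) μ := by
  have hc : Continuous fun x => a (x * z⁻¹) := ha.comp (continuous_mul_const z⁻¹)
  exact (hc.integrable_of_hasCompactSupport
    (hsupp.comp_homeomorph (Homeomorph.mulRight z⁻¹))).smul (Measure.modularCharacterFun z : ℝ)

variable (μ) in
/-- The right translate of a compactly supported continuous function, as an element of `L¹(G)`. -/
def rightTranslateL1 (z : G) : Lp ℂ 1 μ := (integrable_rightTranslate ha hsupp z).toL1

theorem continuous_rightTranslateL1 : Continuous (rightTranslateL1 μ ha hsupp) := by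
  refine continuous_iff_continuousAt.2 fun z₀ => ?_
  obtain ⟨K, hK, hK0⟩ := exists_compact_mem_nhds z₀
  have hz₀ := mem_of_mem_nhds hK0
  have hcont : ContinuousOn
      (fun z => ∫ x, ‖rightTranslate a z x - rightTranslate a z₀ x‖ ∂μ) K := by
    refine continuousOn_integral_of_compact_support (k := tsupport a * K)
      (hsupp.isCompact.mul hK) (Continuous.continuousOn ?_) ?_
    · have hR := continuous_rightTranslate ha
      exact (hR.sub (hR.comp (continuous_const.prodMk continuous_snd))).norm
    · intro z x hz hx
      have hzero : ∀ w ∈ K, rightTranslate a w x = 0 := by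
        intro w hw
        have : a (x * w⁻¹) = 0 := image_eq_zero_of_notMem_tsupport fun h =>
          hx ⟨_, h, w, hw, inv_mul_cancel_right x w⟩
        rw [rightTranslate, this, smul_zero]
      rw [hzero z hz, hzero z₀ hz₀, sub_zero, norm_zero]
  have hdist : ∀ z, dist (rightTranslateL1 μ ha hsupp z) (rightTranslateL1 μ ha hsupp z₀) =
      ∫ x, ‖rightTranslate a z x - rightTranslate a z₀ x‖ ∂μ := by
    intro z
    rw [dist_eq_norm, rightTranslateL1, rightTranslateL1, ← Integrable.toL1_sub,
      L1.norm_of_fun_eq_integral_norm]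
    rfl
  refine tendsto_iff_dist_tendsto_zero.2 ?_
  simp only [hdist]
  have := (hcont.continuousAt hK0).tendsto
  simpa only [sub_self, norm_zero, integral_zero] using this

/-- Right translation of the left factor becomes left translation of the right factor; the modular
factor is exactly the Jacobian of y ↦ y z. -/
theorem conv_rightTranslateL1 (z : G) (g : Lp ℂ 1 μ) :
    conv μ (rightTranslateL1 μ ha hsupp z) g =
      conv μ ((ha.integrable_of_hasCompactSupport (μ := μ) hsupp).toL1) (translate z g) := by
  have h1 : conv μ (rightTranslateL1 μ ha hsupp z) g =
      ∫ y, (Measure.modularCharacterFun z : ℝ) • (a (y * z⁻¹) • translate y g) ∂μ := by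
    refine integral_congr_ae ?_
    filter_upwards [(integrable_rightTranslate (μ := μ) ha hsupp z).coeFn_toL1] with y hy
    rw [rightTranslateL1, hy, rightTranslate, smul_assoc]
  have h2 : conv μ ((ha.integrable_of_hasCompactSupport (μ := μ) hsupp).toL1) (translate z g) =
      ∫ y, a (y * z * z⁻¹) • translate (y * z) g ∂μ := by
    refine integral_congr_ae ?_
    filter_upwards [(ha.integrable_of_hasCompactSupport (μ := μ) hsupp).coeFn_toL1] with y hy
    rw [hy, translate_translate, mul_inv_cancel_right]
  rw [h1, h2, integral_mul_right_eq z fun y => a (y * z⁻¹) • translate y g, integral_smul]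

end RightTranslation

end LeftBiflat

namespace LeftBiflat

/-! ### Amenability of G implies left φ-amenability of L¹(G) -/

section LeftAmenableOfAmenable

variable {G : Type*} [Group G] [TopologicalSpace G] [IsTopologicalGroup G]
  [MeasurableSpace G] [BorelSpace G] [LocallyCompactSpace G] [T2Space G]
  {μ : Measure G} [μ.IsHaarMeasure] [μ.Regular]

/-- Approximation of an integrable function by compactly supported continuous functions. In contrast
with `MemLp.exists_hasCompactSupport_eLpNorm_sub_le`, the space need not be normal. -/
theorem exists_hasCompactSupport_eLpNorm_sub_le {X : Type*} [TopologicalSpace X] [T2Space X]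
    [LocallyCompactSpace X] [MeasurableSpace X] [BorelSpace X] {ν : Measure X} [ν.Regular]
    {f : X → ℂ} (hf : MemLp f 1 ν) {ε : ℝ≥0∞} (hε : ε ≠ 0) :
    ∃ g : X → ℂ, eLpNorm (f - g) 1 ν ≤ ε ∧ Continuous g ∧ HasCompactSupport g := by
  refine hf.induction_dense ENNReal.one_ne_top
    (fun g => Continuous g ∧ HasCompactSupport g) ?_
    (fun f g hf hg => ⟨hf.1.add hg.1,
      HasCompactSupport.comp₂_left (m := fun z w : ℂ => z + w) hf.2 hg.2 (add_zero 0)⟩)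
    (fun f hf => (hf.1.integrable_of_hasCompactSupport (μ := ν) hf.2).aestronglyMeasurable) hε
  intro r s hs hμs ε hε
  obtain ⟨η, hη0, hη⟩ := exists_eLpNorm_indicator_le (μ := ν) ENNReal.one_ne_top r hε
  have hη2 : (η / 2 : ℝ≥0∞) ≠ 0 := by simpa using hη0.ne'
  obtain ⟨K, hKs, hK, hKcl, hsK⟩ := hs.exists_isCompact_isClosed_sdiff_lt hμs.ne hη2
  obtain ⟨U, hKU, hU, -, hUK⟩ :=
    hKcl.measurableSet.exists_isOpen_sdiff_lt (hK.measure_ne_top (μ := ν)) hη2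
  obtain ⟨g, hgK, hgU, hgs, hg01⟩ := exists_continuous_one_zero_of_isCompact hK
    hU.isClosed_compl (Set.disjoint_compl_right_iff_subset.2 hKU)
  refine ⟨fun x => g x • r, ?_, g.continuous.smul continuous_const,
    HasCompactSupport.smul_right (f := ⇑g) (f' := fun _ => r) hgs⟩
  -- The error is at most |r| in modulus and lives on (U \ K) ∪ (s \ K), whose measure is at most η.
  refine (eLpNorm_mono fun x => ?_).trans
    (hη ((U \ K) ∪ (s \ K)) ((measure_union_le _ _).trans
      ((add_le_add hUK.le hsK.le).trans_eq (ENNReal.add_halves _))))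
  by_cases hx : x ∈ K
  · simp [hgK hx, hKs hx]
  rw [Pi.sub_apply]
  by_cases hxU : x ∈ U
  · have hmem : x ∈ (U \ K) ∪ (s \ K) := Or.inl ⟨hxU, hx⟩
    rw [Set.indicator_of_mem hmem]
    by_cases hxs : x ∈ s
    · rw [Set.indicator_of_mem hxs, show g x • r - r = (g x - 1) • r by rw [sub_smul, one_smul],
        norm_smul]
      refine mul_le_of_le_one_left (norm_nonneg _) ?_
      rw [Real.norm_eq_abs, abs_le]
      constructor <;> linarith [(hg01 x).1, (hg01 x).2]
    · rw [Set.indicator_of_notMem hxs, sub_zero, norm_smul]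
      refine mul_le_of_le_one_left (norm_nonneg _) ?_
      rw [Real.norm_eq_abs, abs_le]
      constructor <;> linarith [(hg01 x).1, (hg01 x).2]
  · by_cases hxs : x ∈ s
    · have hmem : x ∈ (U \ K) ∪ (s \ K) := Or.inr ⟨hxs, hx⟩
      rw [Set.indicator_of_mem hmem, Set.indicator_of_mem hxs]
      simp [hgU hxU]
    · simp [hgU hxU, hxs]

variable (μ) in
theorem dense_compactlySupported_L1 :
    Dense {b : Lp ℂ 1 μ | ∃ (a : G → ℂ) (ha : Continuous a) (hsupp : HasCompactSupport a),
      b = (ha.integrable_of_hasCompactSupport (μ := μ) hsupp).toL1} := by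
  intro b
  refine EMetric.mem_closure_iff.2 fun ε hε => ?_
  obtain ⟨δ, hδ0, hδ⟩ := exists_between hε
  obtain ⟨a, hle, ha, hsupp⟩ := exists_hasCompactSupport_eLpNorm_sub_le (Lp.memLp b) hδ0.ne'
  refine ⟨_, ⟨a, ha, hsupp, rfl⟩, ?_⟩
  rw [Lp.edist_def]
  refine lt_of_le_of_lt (le_of_eq_of_le (eLpNorm_congr_ae ?_) hle) hδ
  filter_upwards [(ha.integrable_of_hasCompactSupport (μ := μ) hsupp).coeFn_toL1] with x hx
  rw [Pi.sub_apply, Pi.sub_apply, hx]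

theorem memLp_twistedOrbit (φ F : StrongDual ℂ (Lp ℂ 1 μ)) (c : Lp ℂ 1 μ) :
    MemLp (fun y => F (translate y c) * φ (translate y⁻¹ c)) ∞ μ :=
  memLp_top_of_bound (((continuous_char_translate F c).mul
      ((continuous_char_translate φ c).comp continuous_inv)).aestronglyMeasurable)
    ((‖F‖ * ‖c‖) * (‖φ‖ * ‖c‖)) <| .of_forall fun y => by
      rw [norm_mul]
      exact mul_le_mul (norm_char_translate_le F c y) (norm_char_translate_le φ c y⁻¹)
        (norm_nonneg _) (by positivity)

/-- The operator `F ↦ (y ↦ F(L_y c) χ(y⁻¹))` from `L¹(G)*` to `L^∞(G)`, with `χ(y) = φ(L_y c)`. -/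
def twistedOrbit (φ : StrongDual ℂ (Lp ℂ 1 μ)) (c : Lp ℂ 1 μ) :
    StrongDual ℂ (Lp ℂ 1 μ) →L[ℂ] Lp ℂ ∞ μ :=
  LinearMap.mkContinuous
    { toFun := fun F => (memLp_twistedOrbit φ F c).toLp
      map_add' := fun F H => by
        rw [← MemLp.toLp_add]
        congr 1
        funext y
        exact add_mul _ _ _
      map_smul' := fun r F => by
        rw [RingHom.id_apply, ← MemLp.toLp_const_smul]
        congr 1
        funext y
        exact mul_assoc _ _ _ } (‖c‖ * (‖φ‖ * ‖c‖)) fun F => by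
    refine norm_le_of_ae_bound_top (by positivity) ?_
    filter_upwards [(memLp_twistedOrbit φ F c).coeFn_toLp] with y hy
    change ‖(memLp_twistedOrbit φ F c).toLp _ y‖ ≤ _
    rw [hy, norm_mul]
    refine (mul_le_mul (norm_char_translate_le F c y) (norm_char_translate_le φ c y⁻¹)
        (norm_nonneg _) (by positivity)).trans_eq (by ring)

theorem twistedOrbit_ae_eq (φ F : StrongDual ℂ (Lp ℂ 1 μ)) (c : Lp ℂ 1 μ) :
    twistedOrbit φ c F =ᵐ[μ] fun y => F (translate y c) * φ (translate y⁻¹ c) :=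
  (memLp_twistedOrbit φ F c).coeFn_toLp

variable {φ : StrongDual ℂ (Lp ℂ 1 μ)} (hφ : ∀ f g, φ (conv μ f g) = φ f * φ g)
  {c : Lp ℂ 1 μ} (hc : φ c = 1)
include hφ hc

theorem twistedOrbit_self :
    twistedOrbit φ c φ = (memLp_top_const (1 : ℂ)).toLp (fun _ : G => (1 : ℂ)) := by
  refine Lp.ext ?_
  filter_upwards [twistedOrbit_ae_eq φ φ c, (memLp_top_const (μ := μ) (1 : ℂ)).coeFn_toLp]
    with y h1 h2
  rw [h1, h2, char_translate_mul_inv hφ hc]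

/-- Composing F with L_z moves the orbit point from y to z y; the scalar comes from χ(y⁻¹) = χ(z)
χ((z y)⁻¹). -/
theorem twistedOrbit_dualMap_translateL (z : G) (F : StrongDual ℂ (Lp ℂ 1 μ)) :
    twistedOrbit φ c (dualMap (translateL μ z) F) =
      φ (translate z c) • translate z⁻¹ (twistedOrbit φ c F) := by
  refine Lp.ext ?_
  filter_upwards [twistedOrbit_ae_eq φ (dualMap (translateL μ z) F) c,
    (eventually_mul_left_iff μ z).2 (twistedOrbit_ae_eq φ F c),
    Lp.coeFn_smul (φ (translate z c)) (translate z⁻¹ (twistedOrbit φ c F)),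
    translate_ae_eq z⁻¹ (twistedOrbit φ c F)] with y h1 h2 h3 h4
  have hy : φ (translate y⁻¹ c) = φ (translate z c) * φ (translate (z * y)⁻¹ c) := by
    rw [mul_inv_rev, char_translate_mul hφ hc, mul_left_comm, char_translate_mul_inv hφ hc,
      mul_one]
  rw [h1, h3, Pi.smul_apply, h4, inv_inv, h2, dualMap_apply, translateL_apply, translate_translate,
    smul_eq_mul, hy]
  ring

variable {M : StrongDual ℂ (Lp ℂ ∞ μ)} (hM : ∀ (y : G) (f : Lp ℂ ∞ μ), M (translate y f) = M f)
include hM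

/-- M cannot in general be exchanged with a pointwise integral of translates in L^∞(G). The integral
is therefore taken in L¹(G), over the norm-continuous right translates of a compactly supported a,
where the bounded functional Λ passes through it. Density covers the remaining a and b. -/
theorem mean_twistedOrbit_conv (F : StrongDual ℂ (Lp ℂ 1 μ)) (a b : Lp ℂ 1 μ) :
    M (twistedOrbit φ c (arensAdjoint (convL μ) F (conv μ a b))) =
      φ b * M (twistedOrbit φ c (arensAdjoint (convL μ) F a)) := by
  set Λ : StrongDual ℂ (Lp ℂ 1 μ) :=
    M.comp ((twistedOrbit φ c).comp (arensAdjoint (convL μ) F))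
  change Λ (convL μ a b) = φ b * Λ a
  refine Dense.induction (dense_compactlySupported_L1 μ)
    (P := fun a => ∀ b, Λ (convL μ a b) = φ b * Λ a) ?_ ?_ a b
  swap
  · simp only [Set.ofPred_forall]
    exact isClosed_iInter fun b => isClosed_eq
      (Λ.continuous.comp ((convL μ).flip b).continuous) (continuous_const.mul Λ.continuous)
  rintro _ ⟨f, hf, hfs, rfl⟩ b
  refine Dense.induction (dense_compactlySupported_L1 μ)
    (P := fun b => Λ (convL μ _ b) = φ b * Λ _) ?_ ?_ b
  swap
  · exact isClosed_eq (Λ.continuous.comp (convL μ _).continuous) (φ.continuous.mul_const _)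
  rintro _ ⟨g, hg, hgs, rfl⟩
  set a := (hf.integrable_of_hasCompactSupport (μ := μ) hfs).toL1 with ha
  set R := rightTranslateL1 μ hf hfs with hR
  have hΛR (z : G) : Λ (R z) = φ (translate z c) * Λ a := by
    have h : arensAdjoint (convL μ) F (R z) =
        dualMap (translateL μ z) (arensAdjoint (convL μ) F a) := by
      ext x
      simp only [arensAdjoint_apply, dualMap_apply, translateL_apply, convL_apply, hR,
        conv_rightTranslateL1, ha]
    change M (twistedOrbit φ c (arensAdjoint (convL μ) F (R z))) = _
    rw [h, twistedOrbit_dualMap_translateL hφ hc, map_smul, hM]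
    rfl
  have hint : Integrable (fun z => g z • R z) μ :=
    (hg.smul (continuous_rightTranslateL1 hf hfs)).integrable_of_hasCompactSupport hgs.smul_right
  set b := (hg.integrable_of_hasCompactSupport (μ := μ) hgs).toL1
  have hbg : b =ᵐ[μ] g := (hg.integrable_of_hasCompactSupport (μ := μ) hgs).coeFn_toL1
  -- There is no need to identify a * b with ∫ g(z) R(z) dz: both have the same convolution with
  -- every x, which is all that F · (–) detects.
  have hconv : arensAdjoint (convL μ) F (conv μ a b) =
      arensAdjoint (convL μ) F (∫ z, g z • R z ∂μ) := by
    ext x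
    rw [arensAdjoint_apply, arensAdjoint_apply, convL_apply, conv_assoc]
    congr 1
    change convL μ a (conv μ b x) = (convL μ).flip x (∫ z, g z • R z ∂μ)
    rw [conv, ← ContinuousLinearMap.integral_comp_comm _ (integrable_conv μ b x),
      ← ContinuousLinearMap.integral_comp_comm _ hint]
    refine integral_congr_ae ?_
    filter_upwards [hbg] with z hz
    rw [hz, map_smul, map_smul, convL_apply, ContinuousLinearMap.flip_apply, convL_apply, hR,
      conv_rightTranslateL1]
  calc Λ (convL μ a b) = Λ (∫ z, g z • R z ∂μ) := congrArg (fun H => M (twistedOrbit φ c H)) hconv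
    _ = ∫ z, Λ (g z • R z) ∂μ := (Λ.integral_comp_comm hint).symm
    _ = ∫ z, b z * φ (translate z c) * Λ a ∂μ := by
      refine integral_congr_ae ?_
      filter_upwards [hbg] with z hz
      rw [map_smul, hΛR, hz, smul_eq_mul, mul_assoc]
    _ = φ b * Λ a := by rw [integral_mul_const, ← char_eq_integral hφ hc]

/-- Replacing F by F · c makes m(F) = Λ(c) with Λ depending on F as in `mean_twistedOrbit_conv`.
That lemma and approximate units make Λ vanish on ker φ; applied to b * c - φ(b) c this is the
invariance of m. -/
theorem exists_invariant_bidual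
    (hM1 : M ((memLp_top_const (1 : ℂ)).toLp (fun _ : G => (1 : ℂ))) = 1) :
    ∃ m : Bidual (Lp ℂ 1 μ),
      (∀ a f, m (arensAdjoint (convL μ) f a) = φ a * m f) ∧ m φ = 1 := by
  refine ⟨M.comp ((twistedOrbit φ c).comp ((arensAdjoint (convL μ)).flip c)), fun b F => ?_, ?_⟩
  · set Λ : StrongDual ℂ (Lp ℂ 1 μ) :=
      M.comp ((twistedOrbit φ c).comp (arensAdjoint (convL μ) F))
    have hker : ∀ b, φ b = 0 → Λ b = 0 := by
      intro b hb
      refine closure_minimal ?_ (isClosed_eq Λ.continuous continuous_const)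
        (mem_closure_range_conv b)
      rintro _ ⟨e, rfl⟩
      change Λ (conv μ e b) = 0
      exact (mean_twistedOrbit_conv hφ hc hM F e b).trans (by rw [hb, zero_mul])
    have h : arensAdjoint (convL μ) (arensAdjoint (convL μ) F b) c =
        arensAdjoint (convL μ) F (conv μ b c) := by
      ext x
      simp only [arensAdjoint_apply, convL_apply, conv_assoc]
    change M (twistedOrbit φ c (arensAdjoint (convL μ) (arensAdjoint (convL μ) F b) c)) =
      φ b * Λ c
    rw [h]
    change Λ (conv μ b c) = φ b * Λ c
    have := hker (conv μ b c - φ b • c)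
      (by rw [map_sub, map_smul, hφ, hc, smul_eq_mul, sub_self])
    rwa [map_sub, map_smul, smul_eq_mul, sub_eq_zero] at this
  · have h : arensAdjoint (convL μ) φ c = φ := by
      ext x
      rw [arensAdjoint_apply, convL_apply, hφ, hc, one_mul]
    change M (twistedOrbit φ c (arensAdjoint (convL μ) φ c)) = 1
    rw [h, twistedOrbit_self hφ hc, hM1]

end LeftAmenableOfAmenable

/-! ### The equivalence for L¹(G) -/

section Main

variable {G : Type*} [Group G] [TopologicalSpace G] [IsTopologicalGroup G]
  [MeasurableSpace G] [BorelSpace G] [LocallyCompactSpace G] [T2Space G]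
  {μ : Measure G} [μ.IsHaarMeasure] [μ.Regular]

/-- `L¹(G)` is left `φ`-amenable if and only if `G` is amenable. -/
theorem isLeftAmenable_L1_iff (φ : characterSpace ℂ (L1 μ)) :
    IsLeftAmenable φ ↔ IsAmenable μ := by
  obtain ⟨c, hc⟩ := exists_char_eq_one φ
  have hφ : ∀ f g : Lp ℂ 1 μ, (charDual φ : StrongDual ℂ (Lp ℂ 1 μ)) (conv μ f g) =
      (charDual φ : StrongDual ℂ (Lp ℂ 1 μ)) f * (charDual φ : StrongDual ℂ (Lp ℂ 1 μ)) g :=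
    fun f g => φ.2.2 f g
  constructor
  · rintro ⟨m, hm, hm1⟩
    exact isAmenable_of_invariant_bidual hφ hc (m := m) hm hm1
  · rintro ⟨M, -, hM1, hM⟩
    exact exists_invariant_bidual hφ hc hM hM1

theorem mem_closure_range_mul_L1 (b : L1 μ) : b ∈ closure (Set.range fun e : L1 μ => e * b) :=
  mem_closure_range_conv (μ := μ) b

end Main

end LeftBiflat

end

theorem mainTheorem6 {G : Type*} [Group G] [TopologicalSpace G] [IsTopologicalGroup G]
    [LocallyCompactSpace G] [T2Space G] [MeasurableSpace G] [BorelSpace G]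
    (μ : MeasureTheory.Measure G) [μ.IsHaarMeasure] [μ.Regular]
    (φ : WeakDual.characterSpace ℂ (LeftBiflat.L1 μ)) :
    List.TFAE
      [LeftBiflat.IsLeftBiflat (A := LeftBiflat.ArensBidual (LeftBiflat.L1 μ))
          (LeftBiflat.charExtend φ),
        LeftBiflat.IsLeftBiflat (A := LeftBiflat.L1 μ) φ,
        LeftBiflat.IsAmenable μ] := by
  have happ := LeftBiflat.mem_closure_range_mul_L1 (μ := μ)
  have h := LeftBiflat.isLeftAmenable_L1_iff φ
  tfae_have 1 → 3 := fun h1 => h.1 (LeftBiflat.isLeftAmenable_of_isLeftBiflat_charExtend h1 happ)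
  tfae_have 3 → 1 := fun h3 => (h.2 h3).charExtend.isLeftBiflat
  tfae_have 2 → 3 := fun h2 => h.1 (h2.isLeftAmenable happ)
  tfae_have 3 → 2 := fun h3 => (h.2 h3).isLeftBiflat
  tfae_finish
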